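/- Let $k$ be an algebraically closed field of characteristic $p>0$; a curve means a complete, smooth, connected $1$-dimensional variety over $k$. Let $X$ be a curve, $G$ a finite subgroup of $\operatorname{Aut}_k(X)$, $N$ a normal subgroup of $G$, $\pi: X\to Y=X/N$ the quotient curve, with the induced action of $G/N$ on $Y$. For an effective divisor $D$ on a curve, $\Omega(D)$ denotes the sheaf of meromorphic differentials with poles bounded by $D$. The Cartier operator $\mathcal C$ on meromorphic differentials is defined by $\mathcal C\big((f_0^p+f_1^pt+\dots+f_{p-1}^pt^{p-1})\,dt\big)=f_{p-1}\,dt$, where $t$ is any separating rational function. Then for every $N$-invariant reduced effective divisor $D$ on $X$ there are an effective divisor $E=E_D$ on $Y$ and an isomorphism of sheaves of $\mathcal O_Y$-modules $$\varphi_D:(\pi_*\Omega_X(D))^N\;\xrightarrow{\ \sim\ }\;\Omega_Y(E_D)$$ such that the following hold. 1. (Naturality) $\varphi_D$ is inverse to the pullback of differentials: $\pi^*\varphi_D(\omega)=\omega$ for every local section $\omega$. 2. (Cartier operator) $\mathcal C$ maps local sections of $(\pi_*\Omega_X(D))^N$ and of $\Omega_Y(E_D)$ to sections of the same sheaf, and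 $\varphi_D\circ\mathcal C=\mathcal C\circ\varphi_D$. 3. ($G$-action) For every $g\in G$, with induced automorphism $\bar g$ of $Y$, one has $E_{g^*D}=\bar g^*E_D$ and $\varphi_{g^*D}(g^*\omega)=\bar g^*\varphi_D(\omega)$ for every local section $\omega$ of $(\pi_*\Omega_X(D))^N$. In particular, if $D$ is $G$-invariant, then $G$ acts on both sheaves and $\varphi_D$ commutes with these actions. 4. (Support) The support of $E_D$ is $$\pi(\operatorname{supp} D)\cup\{y\in Y\text{ a closed point}\mid \pi\text{ is wildly ramified over }y\}.$$ -/

import Mathlib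

open CategoryTheory AlgebraicGeometry TopologicalSpace Opposite
open scoped KaehlerDifferential

universe u

noncomputable section

namespace PinkDifferentials

/-! ### Differentials of field extensions and the Cartier operator -/

section Fields

variable (k : Type u) [Field k]

/-- Pullback of differentials along a homomorphism `φ : L → K` of field extensions of `k`:
the additive map `Ω_{L/k} → Ω_{K/k}` with `a • db ↦ φ a • d(φ b)`. -/
def diffMap {k : Type u} [Field k] {L K : Type u} [Field L] [Field K] [Algebra k L] [Algebra k K]
    (φ : L →ₐ[k] K) : Ω[L⁄k] →+ Ω[K⁄k] :=
  letI : Algebra L K := φ.toRingHom.toAlgebra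
  haveI : IsScalarTower k L K := IsScalarTower.of_algebraMap_eq fun x => (φ.commutes x).symm
  (KaehlerDifferential.map k k L K).toAddMonoidHom

theorem diffMap_smul {k : Type u} [Field k] {L K : Type u} [Field L] [Field K] [Algebra k L]
    [Algebra k K] (φ : L →ₐ[k] K) (a : L) (ω : Ω[L⁄k]) :
    diffMap φ (a • ω) = φ a • diffMap φ ω := by
  let : Algebra L K := φ.toRingHom.toAlgebra
  have : IsScalarTower k L K := IsScalarTower.of_algebraMap_eq fun x => (φ.commutes x).symm
  change KaehlerDifferential.map k k L K (a • ω) = φ a • KaehlerDifferential.map k k L K ω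
  rw [map_smul]
  exact algebra_compatible_smul K a _

theorem diffMap_D {k : Type u} [Field k] {L K : Type u} [Field L] [Field K] [Algebra k L]
    [Algebra k K] (φ : L →ₐ[k] K) (a : L) :
    diffMap φ (KaehlerDifferential.D k L a) = KaehlerDifferential.D k K (φ a) := by
  let : Algebra L K := φ.toRingHom.toAlgebra
  have : IsScalarTower k L K := IsScalarTower.of_algebraMap_eq fun x => (φ.commutes x).symm
  exact KaehlerDifferential.map_D k k L K a

variable {K : Type u} [Field K] [Algebra k K]

/-- `t ∈ K` is separating if the field extension `K / k(t)` is (algebraic and) separable. -/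
def IsSeparating (t : K) : Prop :=
  Algebra.IsSeparable (IntermediateField.adjoin k {t}) K

/-- `η = f_{p-1} dt` for some separating `t` with
`ω = (f_0 ^ p + f_1 ^ p t + ⋯ + f_{p-1} ^ p t ^ (p-1)) dt`. -/
def IsCartierValue (p : ℕ) (ω η : Ω[K⁄k]) : Prop :=
  ∃ t : K, IsSeparating k t ∧ ∃ f : ℕ → K,
    ω = (∑ i ∈ Finset.range p, f i ^ p * t ^ i) • KaehlerDifferential.D k K t ∧
    η = f (p - 1) • KaehlerDifferential.D k K t

open Classical in
/-- The Cartier operator on the differentials of `K / k`. For the function field `K` of a curve over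
a perfect field `k` of characteristic `p`, the value `η` with `IsCartierValue k p ω η`
exists and is unique; for other `K` the value may be junk. -/
def cartier (p : ℕ) (ω : Ω[K⁄k]) : Ω[K⁄k] :=
  if h : ∃ η, IsCartierValue k p ω η then h.choose else 0

end Fields

/-! ### Curves -/

/-- A curve over `k`: a complete, smooth, integral `k`-scheme of dimension one. -/
structure Curve (k : Type u) [Field k] where
  toScheme : Scheme.{u}
  str : toScheme ⟶ Spec (CommRingCat.of k)
  [isIntegral : IsIntegral toScheme]
  [isProper : IsProper str]
  [smooth : SmoothOfRelativeDimension 1 str]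

attribute [instance] Curve.isIntegral Curve.isProper Curve.smooth

variable {k : Type u} [Field k]

namespace Curve

/-- A curve as an object of the category of `k`-schemes. -/
abbrev toOver (X : Curve k) : Over (Spec (CommRingCat.of k)) := Over.mk X.str

/-- The function field of a curve. -/
def K (X : Curve k) : Type u := X.toScheme.functionField

instance (X : Curve k) : Field X.K := inferInstanceAs (Field X.toScheme.functionField)

/-- The inclusion of the local ring at `x` into the function field. -/
def toK (X : Curve k) (x : X.toScheme) : X.toScheme.presheaf.stalk x →+* X.K :=
  (X.toScheme.presheaf.stalkSpecializes
    ((genericPoint_spec X.toScheme).specializes trivial)).hom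

/-- The value in the function field of a regular function defined near `x`. -/
def germK (X : Curve k) (U : X.toScheme.Opens) (x : X.toScheme) (hx : x ∈ U) :
    Γ(X.toScheme, U) →+* X.K :=
  (X.toK x).comp (X.toScheme.presheaf.germ U x hx).hom

theorem germK_eq (X : Curve k) (U : X.toScheme.Opens) (x y : X.toScheme) (hx : x ∈ U)
    (hy : y ∈ U) (a : Γ(X.toScheme, U)) : X.germK U x hx a = X.germK U y hy a := by
  have key : ∀ (x : X.toScheme) (hx : x ∈ U), X.germK U x hx =
      (X.toScheme.presheaf.germ U (genericPoint X.toScheme)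
        (((genericPoint_spec X.toScheme).specializes trivial).mem_open U.isOpen hx)).hom := by
    intro x hx
    exact congrArg CommRingCat.Hom.hom (X.toScheme.presheaf.germ_stalkSpecializes hx _)
  rw [key x hx, key y hy]

/-- The inclusion of the constants into the global regular functions. -/
def const (X : Curve k) : k →+* Γ(X.toScheme, ⊤) :=
  ((Scheme.ΓSpecIso (CommRingCat.of k)).inv ≫ X.str.appTop).hom

instance (X : Curve k) : Algebra k X.K :=
  ((X.germK ⊤ (genericPoint X.toScheme) trivial).comp X.const).toAlgebra

/-- A dominant morphism maps the generic point to the generic point. -/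
theorem map_genericPoint_specializes {X Y : Curve k} (f : X.toOver ⟶ Y.toOver)
    [IsDominant f.left] :
    f.left (genericPoint X.toScheme) ⤳ genericPoint Y.toScheme := by
  have h : IsGenericPoint (f.left (genericPoint X.toScheme)) (Set.univ : Set Y.toScheme) := by
    have h1 := (genericPoint_spec X.toScheme).image f.left.continuous
    rwa [Set.image_univ, f.left.denseRange.closure_range] at h1
  exact h.specializes trivial

/-- The inclusion of function fields `f^* : k(Y) → k(X)` of a dominant morphism `f : X → Y`. -/
def pullRing {X Y : Curve k} (f : X.toOver ⟶ Y.toOver) [IsDominant f.left] : Y.K →+* X.K :=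
  (Y.toScheme.presheaf.stalkSpecializes (map_genericPoint_specializes f) ≫
    f.left.stalkMap (genericPoint X.toScheme)).hom

theorem pullRing_toK {X Y : Curve k} (f : X.toOver ⟶ Y.toOver) [IsDominant f.left]
    (x : X.toScheme) (s : Y.toScheme.presheaf.stalk (f.left x)) :
    pullRing f (Y.toK _ s) = X.toK x (f.left.stalkMap x s) := by
  have h := Scheme.Hom.stalkSpecializes_stalkMap_apply f.left (genericPoint X.toScheme) x
    ((genericPoint_spec X.toScheme).specializes trivial) s
  refine Eq.trans ?_ h
  change f.left.stalkMap (genericPoint X.toScheme)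
    (Y.toScheme.presheaf.stalkSpecializes _ (Y.toScheme.presheaf.stalkSpecializes _ s)) = _
  congr 1
  exact ConcreteCategory.congr_hom (Y.toScheme.presheaf.stalkSpecializes_comp _ _) s

theorem pullRing_germK {X Y : Curve k} (f : X.toOver ⟶ Y.toOver) [IsDominant f.left]
    (U : Y.toScheme.Opens) (x : X.toScheme) (hx : f.left x ∈ U) (a : Γ(Y.toScheme, U)) :
    pullRing f (Y.germK U _ hx a) = X.germK (f.left ⁻¹ᵁ U) x hx (f.left.app U a) := by
  change pullRing f (Y.toK _ (Y.toScheme.presheaf.germ U (f.left x) hx a)) = _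
  rw [pullRing_toK]
  exact congrArg (X.toK x) (Scheme.Hom.germ_stalkMap_apply f.left U x hx a)

/-- `f^*` as a homomorphism of extensions of `k`. -/
def pull {X Y : Curve k} (f : X.toOver ⟶ Y.toOver) [IsDominant f.left] : Y.K →ₐ[k] X.K where
  toRingHom := pullRing f
  commutes' a := by
    change pullRing f (Y.germK ⊤ (genericPoint Y.toScheme) trivial (Y.const a)) =
      X.germK ⊤ (genericPoint X.toScheme) trivial (X.const a)
    refine (congrArg (pullRing f) (Y.germK_eq ⊤ _ (f.left (genericPoint X.toScheme))
      trivial trivial _)).trans ((pullRing_germK f ⊤ _ trivial _).trans ?_)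
    refine congrArg (X.germK ⊤ (genericPoint X.toScheme) trivial) ?_
    have h : f.left ≫ Y.str = X.str := Over.w f
    have h2 : Y.str.appTop ≫ f.left.appTop = X.str.appTop := by
      rw [← Scheme.Hom.comp_appTop, h]
    exact ConcreteCategory.congr_hom h2 _

/-- Meromorphic (rational) differentials on a curve. -/
abbrev MerDiff (X : Curve k) : Type u := Ω[X.K⁄k]

/-- Pullback of meromorphic differentials along a dominant morphism. -/
def pullDiff {X Y : Curve k} (f : X.toOver ⟶ Y.toOver) [IsDominant f.left] :
    Y.MerDiff →+ X.MerDiff := diffMap (pull f)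

/-- All functions from the points of `U` to the meromorphic differentials. -/
def FunDiff (X : Curve k) (U : X.toScheme.Opens) : Type u := U → X.MerDiff

instance (X : Curve k) (U : X.toScheme.Opens) : AddCommGroup (X.FunDiff U) :=
  inferInstanceAs (AddCommGroup (U → X.MerDiff))

/-- Regular functions act through their value in the function field. -/
instance (X : Curve k) (U : X.toScheme.Opens) : Module Γ(X.toScheme, U) (X.FunDiff U) where
  smul a s := fun x => X.germK U x x.2 a • s x
  one_smul s := funext fun x => by
    change X.germK U x x.2 1 • s x = s x
    rw [map_one, one_smul]
  mul_smul a b s := funext fun x => by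
    change X.germK U x x.2 (a * b) • s x = X.germK U x x.2 a • X.germK U x x.2 b • s x
    rw [map_mul, mul_smul]
  smul_zero a := funext fun x => smul_zero (X.germK U x x.2 a)
  smul_add a s t := funext fun x => smul_add (X.germK U x x.2 a) (s x) (t x)
  add_smul a b s := funext fun x => by
    change X.germK U x x.2 (a + b) • s x = X.germK U x x.2 a • s x + X.germK U x x.2 b • s x
    rw [map_add, add_smul]
  zero_smul s := funext fun x => by
    change X.germK U x x.2 0 • s x = 0
    rw [map_zero, zero_smul]

instance (X : Curve k) (U : (X.toScheme.Opens)ᵒᵖ) :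
    Module (X.toScheme.ringCatSheaf.obj.obj U) (X.FunDiff U.unop) :=
  inferInstanceAs (Module Γ(X.toScheme, U.unop) (X.FunDiff U.unop))

/-- Restriction. -/
def FunDiff.res {X : Curve k} {U V : X.toScheme.Opens} (h : V ≤ U) (s : X.FunDiff U) :
    X.FunDiff V := fun x => s ⟨x, h x.2⟩

theorem germK_res (X : Curve k) {U V : X.toScheme.Opens} (i : V ⟶ U) (x : X.toScheme)
    (hx : x ∈ V) (a : Γ(X.toScheme, U)) :
    X.germK V x hx (X.toScheme.presheaf.map i.op a) = X.germK U x (i.le hx) a :=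
  congrArg (X.toK x) (TopCat.Presheaf.germ_res_apply X.toScheme.presheaf i x hx a)

/-- The presheaf of modules of all functions with values in the meromorphic differentials. -/
def funDiffPresheaf (X : Curve k) : X.toScheme.PresheafOfModules where
  obj U := ModuleCat.of (X.toScheme.ringCatSheaf.obj.obj U) (X.FunDiff U.unop)
  map {U V} i := ModuleCat.semilinearMapAddEquiv _ _ _
    { toFun := FunDiff.res i.unop.le
      map_add' := fun s t => rfl
      map_smul' := fun a s => funext fun x => by
        change X.germK U.unop x _ a • s _ = X.germK V.unop x x.2 (X.toScheme.presheaf.map i a) • s _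
        exact congrArg (· • s ⟨x, i.unop.le x.2⟩) (X.germK_res i.unop x x.2 a).symm }
  map_id U := by ext; rfl
  map_comp i j := by ext; rfl

end Curve

/-- The sheaf condition as unique gluing. -/
theorem isSheaf_of_gluing {S : Scheme.{u}} (M : S.PresheafOfModules)
    (h : ∀ ⦃ι : Type u⦄ (U : ι → S.Opens) (s : ∀ i, M.obj (op (U i))),
      (∀ i j, M.map (Opens.infLELeft (U i) (U j)).op (s i) =
        M.map (Opens.infLERight (U i) (U j)).op (s j)) →
      ∃! t : M.obj (op (iSup U)), ∀ i, M.map (Opens.leSupr U i).op t = s i) :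
    TopCat.Presheaf.IsSheaf M.presheaf :=
  (TopCat.Presheaf.isSheaf_iff_isSheafUniqueGluing _).mpr fun _ U s hs =>
    h U (fun i => s i) (fun i j => hs i j)

/-- A submodule presheaf of a sheaf of modules, given by a local condition, is a sheaf. -/
def subModules {S : Scheme.{u}} (M : S.Modules) (P : PresheafOfModules.Submodule M.val)
    (hP : ∀ ⦃ι : Type u⦄ (U : ι → S.Opens) (t : M.val.obj (op (iSup U))),
      (∀ i, M.val.map (Opens.leSupr U i).op t ∈ P.obj (op (U i))) → t ∈ P.obj (op (iSup U))) :
    S.Modules where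
  val := P.toPresheafOfModules
  isSheaf := isSheaf_of_gluing _ fun ι U s hs => by
    obtain ⟨t, ht, huniq⟩ := (TopCat.Presheaf.isSheaf_iff_isSheafUniqueGluing _).mp M.isSheaf U
      (fun i => (s i).1) (fun i j => congrArg Subtype.val (hs i j))
    refine ⟨⟨t, hP U t fun i => ?_⟩, fun i => Subtype.ext (ht i), fun t' ht' => Subtype.ext ?_⟩
    · have := ht i
      change M.val.map (Opens.leSupr U i).op t = (s i).1 at this
      rw [this]
      exact (s i).2
    · exact huniq t'.1 fun i => congrArg Subtype.val (ht' i)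

namespace Curve

/-- The sheaf of modules of all functions with values in the meromorphic differentials. -/
def funDiffSheaf (X : Curve k) : X.toScheme.Modules where
  val := X.funDiffPresheaf
  isSheaf := isSheaf_of_gluing _ fun ι U s hs => by
    have hmem : ∀ x : (iSup U : X.toScheme.Opens), ∃ i, (x : X.toScheme) ∈ U i := fun x =>
      Opens.mem_iSup.mp x.2
    choose ix hix using hmem
    refine ⟨fun x => s (ix x) ⟨x, hix x⟩, fun i => funext fun x => ?_, fun t ht => ?_⟩
    · exact congrFun (hs (ix ⟨x, Opens.mem_iSup.mpr ⟨i, x.2⟩⟩) i) ⟨x, ⟨hix _, x.2⟩⟩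
    · exact funext fun x => congrFun (ht (ix x)) ⟨x, hix x⟩

end Curve

/-- An effective divisor on a curve: closed points with multiplicities. -/
structure EffectiveDivisor (X : Curve k) where
  mult : X.toScheme →₀ ℕ
  isClosed : ∀ x, mult x ≠ 0 → IsClosed {x}

namespace Curve

/-- The stalk at `x` of the invertible sheaf `O_X(D)`, the inverse of the ideal sheaf of `D`:
rational functions `f` with `m_x ^ D(x) f ⊆ O_{X,x}`. -/
def polesLE (X : Curve k) (D : EffectiveDivisor X) (x : X.toScheme) : Set X.K :=
  {f | ∀ a ∈ IsLocalRing.maximalIdeal (X.toScheme.presheaf.stalk x) ^ D.mult x,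
    X.toK x a * f ∈ (X.toK x).range}

/-- The stalk at `x` of `Ω_X(D) = Ω_X ⊗ O_X(D)`, as a group of meromorphic differentials: it is
generated by the differentials `f dg` with `f` in the stalk of `O_X(D)` and `g ∈ O_{X,x}`. -/
def omegaStalk (X : Curve k) (D : EffectiveDivisor X) (x : X.toScheme) : AddSubgroup X.MerDiff :=
  AddSubgroup.closure {ω | ∃ f ∈ X.polesLE D x, ∃ g : X.toScheme.presheaf.stalk x,
    ω = f • KaehlerDifferential.D k X.K (X.toK x g)}

theorem smul_mem_omegaStalk (X : Curve k) (D : EffectiveDivisor X) (x : X.toScheme)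
    (a : X.toScheme.presheaf.stalk x) {ω : X.MerDiff} (hω : ω ∈ X.omegaStalk D x) :
    X.toK x a • ω ∈ X.omegaStalk D x := by
  induction hω using AddSubgroup.closure_induction with
  | mem ω h =>
    obtain ⟨f, hf, g, rfl⟩ := h
    refine AddSubgroup.subset_closure ⟨X.toK x a * f, fun b hb => ?_, g, smul_smul _ _ _⟩
    rw [mul_left_comm]
    exact (X.toK x).range.mul_mem ⟨a, rfl⟩ (hf b hb)
  | zero => rw [smul_zero]; exact zero_mem _
  | add _ _ _ _ h₁ h₂ => rw [smul_add]; exact add_mem h₁ h₂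
  | neg _ _ h => rw [smul_neg]; exact neg_mem h

/-- The sections of `Ω_X(D)` over `U`: a section is a meromorphic differential, that is, a constant
function on `U` with values in the meromorphic differentials (so that the only section over the
empty set is zero), which lies in the stalk of `Ω_X(D)` at each point of `U`. -/
def omegaSections (X : Curve k) (D : EffectiveDivisor X) (U : X.toScheme.Opens) :
    Submodule Γ(X.toScheme, U) (X.FunDiff U) where
  carrier := {s | (∀ x : U, s x ∈ X.omegaStalk D x) ∧ ∀ x y : U, s x = s y}
  add_mem' := fun hs ht => ⟨fun x => add_mem (hs.1 x) (ht.1 x), fun x y =>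
    congrArg₂ (· + ·) (hs.2 x y) (ht.2 x y)⟩
  zero_mem' := ⟨fun _ => zero_mem _, fun _ _ => rfl⟩
  smul_mem' := fun a _ hs => ⟨fun x => X.smul_mem_omegaStalk D x _ (hs.1 x), fun x y =>
    congrArg₂ (fun (c : X.K) (ω : X.MerDiff) => c • ω)
      (X.germK_eq U x y x.2 y.2 a) (hs.2 x y)⟩

/-- The sections of `Ω_X(D)` as a subpresheaf of modules. -/
def omegaSub (X : Curve k) (D : EffectiveDivisor X) :
    PresheafOfModules.Submodule X.funDiffSheaf.val where
  obj U := X.omegaSections D U.unop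
  map i := fun _ hs => ⟨fun x => hs.1 ⟨x, i.unop.le x.2⟩, fun x y =>
    hs.2 ⟨x, i.unop.le x.2⟩ ⟨y, i.unop.le y.2⟩⟩

/-- The sheaf of `O_X`-modules `Ω_X(D)`. -/
def Omega (X : Curve k) (D : EffectiveDivisor X) : X.toScheme.Modules :=
  subModules X.funDiffSheaf (X.omegaSub D) fun ι U t ht => by
    refine ⟨fun x => ?_, fun x y => ?_⟩
    · obtain ⟨i, hi⟩ := Opens.mem_iSup.mp x.2
      exact (ht i).1 ⟨x, hi⟩
    · obtain ⟨i, hi⟩ := Opens.mem_iSup.mp x.2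
      obtain ⟨j, hj⟩ := Opens.mem_iSup.mp y.2
      have gi := ((genericPoint_spec X.toScheme).specializes trivial).mem_open (U i).isOpen hi
      have gj := ((genericPoint_spec X.toScheme).specializes trivial).mem_open (U j).isOpen hj
      exact ((ht i).2 ⟨x, hi⟩ ⟨_, gi⟩).trans ((ht j).2 ⟨_, gj⟩ ⟨y, hj⟩)

/-- The value at a point of a section of `Ω_X(D)`, as a meromorphic differential. -/
def Omega.val {X : Curve k} {D : EffectiveDivisor X} {U : X.toScheme.Opens}
    (s : Γ(X.Omega D, U)) (x : X.toScheme) (hx : x ∈ U) : X.MerDiff :=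
  (show X.omegaSections D U from s).1 ⟨x, hx⟩

instance {X : Curve k} (g : Aut X.toOver) : IsDominant g.hom.left := by
  have : IsIso g.hom.left := ((Over.forget _).mapIso g).isIso_hom
  infer_instance

theorem germK_app_congr {X Y : Curve k} {f g : X.toScheme ⟶ Y.toScheme} (h : f = g)
    (U : Y.toScheme.Opens) (x : X.toScheme) (hf : x ∈ f ⁻¹ᵁ U) (hg : x ∈ g ⁻¹ᵁ U)
    (a : Γ(Y.toScheme, U)) :
    X.germK (f ⁻¹ᵁ U) x hf (f.app U a) = X.germK (g ⁻¹ᵁ U) x hg (g.app U a) := by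
  subst h; rfl

/-- The `N`-invariant sections of `π_* Ω_X(D)` over `U`. -/
def invSections {X Y : Curve k} (N : Subgroup (Aut X.toOver)) (π : X.toOver ⟶ Y.toOver)
    (hπ : ∀ n ∈ N, n.hom ≫ π = π) (D : EffectiveDivisor X) (U : Y.toScheme.Opens) :
    Submodule Γ(Y.toScheme, U) Γ((Scheme.Modules.pushforward π.left).obj (X.Omega D), U) where
  carrier := {s | ∀ n ∈ N, ∀ x (hx : x ∈ π.left ⁻¹ᵁ U) (hnx : n.hom.left x ∈ π.left ⁻¹ᵁ U),
    pullDiff n.hom (Omega.val s _ hnx) = Omega.val s x hx}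
  add_mem' := fun {s t} hs ht n hn x hx hnx =>
    (map_add (pullDiff n.hom) (Omega.val s _ hnx) (Omega.val t _ hnx)).trans
      (congrArg₂ (· + ·) (hs n hn x hx hnx) (ht n hn x hx hnx))
  zero_mem' := fun n hn x hx hnx => map_zero (pullDiff n.hom)
  smul_mem' := fun a s hs n hn x hx hnx => by
    have key : pullRing n.hom (X.germK (π.left ⁻¹ᵁ U) _ hnx (π.left.app U a)) =
        X.germK (π.left ⁻¹ᵁ U) x hx (π.left.app U a) := by
      refine (pullRing_germK n.hom (π.left ⁻¹ᵁ U) x hnx _).trans ?_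
      have h : n.hom.left ≫ π.left = π.left := congrArg CommaMorphism.left (hπ n hn)
      refine Eq.trans ?_ (germK_app_congr h U x hnx hx a)
      exact congrArg (X.germK (n.hom.left ⁻¹ᵁ π.left ⁻¹ᵁ U) x hnx)
        (ConcreteCategory.congr_hom (Scheme.Hom.comp_app n.hom.left π.left U) a).symm
    refine (diffMap_smul (pull n.hom) _ (Omega.val s _ hnx)).trans ?_
    exact congrArg₂ (fun (c : X.K) (ω : X.MerDiff) => c • ω) key (hs n hn x hx hnx)

/-- The `N`-invariant sections of `π_* Ω_X(D)` as a subpresheaf of modules. -/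
def invSub {X Y : Curve k} (N : Subgroup (Aut X.toOver)) (π : X.toOver ⟶ Y.toOver)
    (hπ : ∀ n ∈ N, n.hom ≫ π = π) (D : EffectiveDivisor X) :
    PresheafOfModules.Submodule ((Scheme.Modules.pushforward π.left).obj (X.Omega D)).val where
  obj U := invSections N π hπ D U.unop
  map i := fun _ hs n hn x hx hnx => hs n hn x (i.unop.le hx) (i.unop.le hnx)

/-- The sheaf of `O_Y`-modules `(π_* Ω_X(D))^N`, for an `N`-invariant morphism `π : X → Y`. -/
def InvOmega {X Y : Curve k} (N : Subgroup (Aut X.toOver)) (π : X.toOver ⟶ Y.toOver)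
    (hπ : ∀ n ∈ N, n.hom ≫ π = π) (D : EffectiveDivisor X) : Y.toScheme.Modules :=
  subModules ((Scheme.Modules.pushforward π.left).obj (X.Omega D)) (invSub N π hπ D)
    fun ι U t ht n hn x hx hnx => by
      obtain ⟨i, hi⟩ := Opens.mem_iSup.mp hx
      have h : π.left (n.hom.left x) = π.left x :=
        congrArg (fun f : X.toOver ⟶ Y.toOver => f.left x) (hπ n hn)
      have hi' : π.left (n.hom.left x) ∈ U i := h ▸ hi
      exact ht i n hn x hi hi'

/-- The value at a point `x` over `U` of a section of `(π_* Ω_X(D))^N` over `U`. -/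
def InvOmega.val {X Y : Curve k} {N : Subgroup (Aut X.toOver)} {π : X.toOver ⟶ Y.toOver}
    {hπ : ∀ n ∈ N, n.hom ≫ π = π} {D : EffectiveDivisor X} {U : Y.toScheme.Opens}
    (s : Γ(InvOmega N π hπ D, U)) (x : X.toScheme) (hx : π.left x ∈ U) : X.MerDiff :=
  Omega.val (U := π.left ⁻¹ᵁ U) (show invSections N π hπ D U from s).1 x hx

end Curve

/-! ### Quotients, divisors and ramification -/

open Curve

variable {X Y : Curve k}

/-- `π : X → Y` exhibits `Y` as the quotient `X / N`: as a topological space `Y` is the space of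
`N`-orbits with the quotient topology, and `O_Y` is the sheaf `(π_* O_X)^N`. -/
structure IsQuotient (N : Subgroup (Aut X.toOver)) (π : X.toOver ⟶ Y.toOver) : Prop where
  invariant : ∀ n ∈ N, n.hom ≫ π = π
  isQuotientMap : Topology.IsQuotientMap π.left
  orbit : ∀ x x', π.left x = π.left x' → ∃ n ∈ N, n.hom.left x = x'
  injective : ∀ U : Y.toScheme.Opens, Function.Injective (π.left.app U)
  surjective : ∀ (U : Y.toScheme.Opens) (a : Γ(X.toScheme, π.left ⁻¹ᵁ U)),
    (∀ n ∈ N, ∀ h : π.left ⁻¹ᵁ U ≤ n.hom.left ⁻¹ᵁ (π.left ⁻¹ᵁ U),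
      n.hom.left.appLE (π.left ⁻¹ᵁ U) (π.left ⁻¹ᵁ U) h a = a) →
    ∃ b : Γ(Y.toScheme, U), π.left.app U b = a

theorem IsQuotient.isDominant {N : Subgroup (Aut X.toOver)} {π : X.toOver ⟶ Y.toOver}
    (h : IsQuotient N π) : IsDominant π.left :=
  ⟨h.isQuotientMap.surjective.denseRange⟩

/-- Pullback of meromorphic differentials along a quotient morphism. -/
def IsQuotient.pullDiff {N : Subgroup (Aut X.toOver)} {π : X.toOver ⟶ Y.toOver}
    (h : IsQuotient N π) : Y.MerDiff →+ X.MerDiff :=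
  haveI := h.isDominant
  Curve.pullDiff π

/-- The divisor is reduced: all multiplicities are at most one. -/
def EffectiveDivisor.IsReduced (D : EffectiveDivisor X) : Prop := ∀ x, D.mult x ≤ 1

/-- `D' = g^* D` for an automorphism `g`. -/
def EffectiveDivisor.IsPullback (g : Aut X.toOver) (D D' : EffectiveDivisor X) : Prop :=
  ∀ x, D'.mult x = D.mult (g.hom.left x)

/-- The divisor is invariant under the group `N`. -/
def EffectiveDivisor.IsInvariant (N : Subgroup (Aut X.toOver)) (D : EffectiveDivisor X) : Prop :=
  ∀ n ∈ N, D.IsPullback n D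

/-- The ramification index of `π` at `x`: the length of `O_{X,x} / m_{π(x)} O_{X,x}`. -/
def ramificationIndex (π : X.toOver ⟶ Y.toOver) (x : X.toScheme) : ℕ :=
  letI : Algebra (Y.toScheme.presheaf.stalk (π.left x)) (X.toScheme.presheaf.stalk x) :=
    (π.left.stalkMap x).hom.toAlgebra
  (IsLocalRing.maximalIdeal (X.toScheme.presheaf.stalk x)).ramificationIdx
    (Y.toScheme.presheaf.stalk (π.left x))

/-- Over the closed point `y`, the morphism `π` is wildly ramified (in residue characteristic `p`
and with algebraically closed residue fields). -/
def IsWildlyRamifiedOver (p : ℕ) (π : X.toOver ⟶ Y.toOver) (y : Y.toScheme) : Prop :=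
  IsClosed {y} ∧ ∃ x, IsClosed {x} ∧ π.left x = y ∧ p ∣ ramificationIndex π x

end PinkDifferentials
end

open PinkDifferentials

/-!
Write `K` for the function field of `X` and `L = K ^ N` for that of `Y`. Since `K / L` is a finite
Galois extension, the pullback `Ω_{L/k} → Ω_{K/k}` is injective with image the `N`-invariant
differentials: both spaces are lines, so fixing `t ∈ L` with `dt ≠ 0` (whose pullback is nonzero by
separability), every invariant differential is `f dt` with `f` invariant
(`IsQuotient.exists_pullDiff_eq`). The isomorphism is the inverse of this pullback, and everything
else is local at the closed points.

Let `x` be a closed point over `y`, with local parameters `u` and `v`, and let `e` be the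
ramification index. Then `v = a u ^ e` and `dv = b u ^ d du` with `a` and `b` units at `x`
(`IsQuotient.exists_local_form`). Differentiating the first expression gives `d ≥ e - 1`, with
equality exactly when `p ∤ e`. A differential `v ^ (-m) c dv`, with `c` a unit at `y`, pulls
back to a unit times `u ^ (d - m e) du`. Hence its pullback has a pole of order at most `D(x)` if
and only if `m ≤ ⌊(d + D(x)) / e⌋`, and this number is the multiplicity of `E_D` at `y`. It does not
depend on the choice of `x` because `N` permutes the points over `y` transitively and leaves `D`
invariant. As `D(x) ≤ 1`, it is nonzero if and only if `D(x) = 1` or `d ≥ e`, that is, `D(x) = 1` or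
`π` is wildly ramified at `x`; this gives the support of `E_D`. There are finitely many such
points: for a fixed `t ∈ L` with `dt ≠ 0`, the pullback of `dt` generates `Ω_X` outside a finite
set, and `d = 0` where it does and `t` is regular (`IsQuotient.finite_dvd_ramificationIndex`).

An effective divisor on `Y` is determined by the stalks of its sheaf of differentials, so `E_D` is
characterised by `ω ∈ Ω_Y(E_D)_{π(x)} ↔ π^* ω ∈ Ω_X(D)_x`. From this characterisation the
compatibility with `G` is formal. The Cartier operator commutes with the pullback because a
separating `t ∈ L` remains separating in `K` (`IsQuotient.cartier_pullDiff`) and its value does not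
depend on the choice of `t` (`IsCartierValueAt.change`). It preserves `Ω_X(D)` because of the formula
`(d / dt) ^ (p - 1) (f_0 ^ p + ⋯ + f_{p-1} ^ p t ^ (p - 1)) = - f_{p-1} ^ p`, applied to a local
parameter `t = u` (`IsLocalParameter.poleLE_cartier`).

That a closed point has a local parameter `u`, with `du` a basis of the differentials, uses that a
standard smooth algebra has free differentials and that the cotangent space of a closed point over
an algebraically closed field embeds in the fibre of the differentials
(`Curve.isLocalParameter_and_isDiscreteValuationRing`).
-/

/-! ### Differentials of function fields -/

noncomputable section

namespace PinkDifferentials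

open KaehlerDifferential (D)

section FunctionField

variable {k : Type u} [Field k] {K : Type u} [Field K] [Algebra k K]

/-- In a formally unramified extension `K / L`, the differentials of elements of `L` span
`Ω_{K/k}` over `K`. -/
theorem eq_top_of_D_algebraMap_mem {L : Type u} [Field L] [Algebra k L] [Algebra L K]
    [IsScalarTower k L K] [Algebra.FormallyUnramified L K] (W : Submodule K Ω[K⁄k])
    (hW : ∀ a : L, D k K (algebraMap L K a) ∈ W) : W = ⊤ := by
  have h1 : LinearMap.range (KaehlerDifferential.mapBaseChange k L K) = ⊤ := by
    rw [KaehlerDifferential.range_mapBaseChange, eq_top_iff]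
    intro x _
    exact Subsingleton.elim _ _
  rw [eq_top_iff, ← h1]
  rintro _ ⟨z, rfl⟩
  induction z with
  | zero => simp
  | add a b ha hb => rw [map_add]; exact add_mem ha hb
  | tmul r s =>
    rw [KaehlerDifferential.mapBaseChange_tmul]
    refine W.smul_mem _ ?_
    have hs : s ∈ Submodule.span L (Set.range (D k L)) := by
      rw [KaehlerDifferential.span_range_derivation]; trivial
    induction hs using Submodule.span_induction with
    | mem x hx => obtain ⟨a, rfl⟩ := hx; rw [KaehlerDifferential.map_D]; exact hW a
    | zero => simp
    | add _ _ _ _ h1 h2 => rw [map_add]; exact add_mem h1 h2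
    | smul a x _ hx =>
      rw [map_smul, algebra_compatible_smul K]; exact W.smul_mem _ hx

/-- The elements whose differential lies in a given subspace of `Ω_{K/k}` form a subfield
containing `k`. -/
def lineSubfield (k : Type u) [Field k] {K : Type u} [Field K] [Algebra k K]
    (W : Submodule K Ω[K⁄k]) : IntermediateField k K where
  carrier := {f | D k K f ∈ W}
  mul_mem' {a b} ha hb := by
    change D k K (a * b) ∈ W
    rw [Derivation.leibniz]
    exact add_mem (W.smul_mem _ hb) (W.smul_mem _ ha)
  add_mem' {a b} ha hb := by
    change D k K (a + b) ∈ W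
    rw [map_add]; exact add_mem ha hb
  algebraMap_mem' c := by
    change D k K (algebraMap k K c) ∈ W
    rw [Derivation.map_algebraMap]; exact zero_mem _
  inv_mem' a ha := by
    change D k K a⁻¹ ∈ W
    rw [Derivation.leibniz_inv]
    exact W.smul_mem _ ha

theorem mem_lineSubfield {W : Submodule K Ω[K⁄k]} {f : K} :
    f ∈ lineSubfield k W ↔ D k K f ∈ W := Iff.rfl

theorem exists_smul_D_of_D_ne_zero (hΩ : Module.finrank K Ω[K⁄k] = 1) {t : K} (ht : D k K t ≠ 0)
    (ω : Ω[K⁄k]) : ∃ f : K, ω = f • D k K t := by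
  obtain ⟨c, hc⟩ := (finrank_eq_one_iff_of_nonzero' _ ht).mp hΩ ω
  exact ⟨c, hc.symm⟩

theorem exists_D_ne_zero (hΩ : Module.finrank K Ω[K⁄k] = 1) : ∃ t : K, D k K t ≠ 0 := by
  by_contra! h
  have h2 : (⊥ : Submodule K Ω[K⁄k]) = ⊤ := by
    rw [eq_top_iff, ← KaehlerDifferential.span_range_derivation, Submodule.span_le]
    rintro _ ⟨f, rfl⟩
    exact h f
  have : Subsingleton Ω[K⁄k] := (Submodule.subsingleton_iff K).mp (subsingleton_of_bot_eq_top h2)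
  rw [Module.finrank_zero_of_subsingleton] at hΩ
  exact zero_ne_one hΩ

/-- If `dt` generates `Ω_{K/k}`, then `K` has no differentials over `k(t)`, so that the finitely
generated extension `K / k(t)` is separable algebraic. -/
theorem isSeparating_of_D_ne_zero [Algebra.EssFiniteType k K]
    (hΩ : Module.finrank K Ω[K⁄k] = 1) {t : K} (ht : D k K t ≠ 0) : IsSeparating k t := by
  let F := IntermediateField.adjoin k {t}
  have : Algebra.EssFiniteType F K := Algebra.EssFiniteType.of_comp k F K
  have h : Subsingleton Ω[K⁄F] := by
    refine subsingleton_of_forall_eq 0 fun η => ?_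
    obtain ⟨ω, rfl⟩ := KaehlerDifferential.map_surjective k F K η
    obtain ⟨f, rfl⟩ := exists_smul_D_of_D_ne_zero hΩ ht ω
    rw [map_smul, KaehlerDifferential.map_D]
    have : D F K (algebraMap F K ⟨t, IntermediateField.mem_adjoin_simple_self k t⟩) = 0 :=
      Derivation.map_algebraMap _ _
    exact (congrArg (f • ·) this).trans (smul_zero _)
  have : Algebra.FormallyUnramified F K := ⟨h⟩
  exact Algebra.FormallyUnramified.isSeparable F K

theorem IsSeparating.D_ne_zero (hΩ : Module.finrank K Ω[K⁄k] = 1) {t : K}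
    (ht : IsSeparating k t) : D k K t ≠ 0 := by
  intro h0
  let F := IntermediateField.adjoin k {t}
  have : Algebra.IsSeparable F K := ht
  have : Algebra.FormallyUnramified F K := Algebra.FormallyUnramified.of_isSeparable F K
  have hF : F ≤ lineSubfield k (⊥ : Submodule K Ω[K⁄k]) := by
    rw [IntermediateField.adjoin_le_iff]
    rintro _ rfl
    exact h0
  have h2 : (⊥ : Submodule K Ω[K⁄k]) = ⊤ :=
    eq_top_of_D_algebraMap_mem (L := F) _ fun a => hF a.2
  have : Subsingleton Ω[K⁄k] := (Submodule.subsingleton_iff K).mp (subsingleton_of_bot_eq_top h2)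
  rw [Module.finrank_zero_of_subsingleton] at hΩ
  exact zero_ne_one hΩ

/-- The derivation `d / dt`. -/
theorem exists_derivation (hΩ : Module.finrank K Ω[K⁄k] = 1) {t : K} (ht : D k K t ≠ 0) :
    ∃ δ : Derivation k K K, ∀ g, D k K g = δ g • D k K t := by
  obtain ⟨ℓ, hℓ⟩ := Module.Projective.exists_dual_ne_zero K ht
  refine ⟨((ℓ (D k K t))⁻¹ • ℓ).compDer (D k K), fun g => ?_⟩
  obtain ⟨c, hc⟩ := exists_smul_D_of_D_ne_zero hΩ ht (D k K g)
  rw [hc]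
  congr 1
  simp [hc, mul_comm c, inv_mul_cancel_left₀ hℓ]

end FunctionField

/-! ### Expansions in powers of a separating element -/

section PthPowers

variable {k : Type u} [Field k] {K : Type u} [Field K] [Algebra k K] (p : ℕ) [CharP K p]

theorem derivation_pow_char {M : Type*} [AddCommGroup M] [Module K M] [Module k M]
    (δ : Derivation k K M) (f : K) : δ (f ^ p) = 0 := by
  rw [Derivation.leibniz_pow, ← Nat.cast_smul_eq_nsmul K, CharP.cast_eq_zero, zero_smul]

variable [Fact p.Prime]

/-- If `k` is perfect and `t` is separating, then `1, t, …, t ^ (p - 1)` span `K` over `K ^ p`. -/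
theorem IsSeparating.exists_sum_pow [PerfectRing k p] {t : K} (ht : IsSeparating k t) (g : K) :
    ∃ f : ℕ → K, g = ∑ i ∈ Finset.range p, f i ^ p * t ^ i := by
  let F := IntermediateField.adjoin k {t}
  have : Algebra.IsSeparable F K := ht
  have hp : p.Prime := Fact.out
  have : CharP F p := (algebraMap F K).charP (algebraMap F K).injective p
  have : ExpChar F p := ExpChar.prime hp
  let L : Subfield K := (frobenius K p).fieldRange
  have hL : ∀ a : K, a ^ p ∈ L := fun a => ⟨a, rfl⟩
  have hLe : ∀ a : L, ∃ b : K, b ^ p = algebraMap L K a := fun a => a.2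
  let M := IntermediateField.adjoin L {t}
  have htM : t ∈ M := IntermediateField.mem_adjoin_simple_self L t
  have hLM : ∀ a : K, a ^ p ∈ M := fun a => M.algebraMap_mem ⟨a ^ p, hL a⟩
  have hkM : ∀ c : k, algebraMap k K c ∈ M := fun c => by
    obtain ⟨b, rfl⟩ := (PerfectRing.bijective_frobenius (R := k) (p := p)).2 c
    exact (map_pow (algebraMap k K) b p).symm ▸ hLM _
  have hFM : ∀ a : F, (a : K) ∈ M := fun a => by
    refine IntermediateField.adjoin_induction k (p := fun x _ => x ∈ M) ?_ hkM
      (fun _ _ _ _ h1 h2 => add_mem h1 h2) (fun _ _ h => inv_mem h)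
      (fun _ _ _ _ h1 h2 => mul_mem h1 h2) a.2
    rintro _ rfl
    exact htM
  -- `K` is separable over `k(t)`, hence generated over it by `p`-th powers, and `k` consists of
  -- `p`-th powers, so that `K` is generated by `t` over `K ^ p`
  have hgM : g ∈ M := by
    have h1 : g ∈ IntermediateField.adjoin F ((· ^ p) '' (Set.univ : Set K)) := by
      rw [← IntermediateField.adjoin_eq_adjoin_pow_expChar_of_isSeparable' F K]
      exact IntermediateField.subset_adjoin F _ trivial
    refine IntermediateField.adjoin_induction F (p := fun x _ => x ∈ M) ?_ hFM
      (fun _ _ _ _ h1 h2 => add_mem h1 h2) (fun _ _ h => inv_mem h)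
      (fun _ _ _ _ h1 h2 => mul_mem h1 h2) h1
    rintro _ ⟨a, -, rfl⟩
    exact hLM a
  -- `t` is a root of `X ^ p - t ^ p`, so polynomials in `t` can be reduced to degree `< p`
  let Q : Polynomial L := Polynomial.X ^ p - Polynomial.C ⟨t ^ p, hL t⟩
  have hQ : Q.Monic := Polynomial.monic_X_pow_sub_C _ hp.ne_zero
  have hQt : Polynomial.aeval t Q = 0 := by
    simp only [Q, map_sub, map_pow, Polynomial.aeval_X, Polynomial.aeval_C]
    exact sub_self _
  have htalg : IsAlgebraic L t := ⟨Q, hQ.ne_zero, hQt⟩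
  have hgA : g ∈ Algebra.adjoin L {t} := by
    rw [← IntermediateField.adjoin_simple_toSubalgebra_of_isAlgebraic htalg]
    exact hgM
  rw [Algebra.adjoin_singleton_eq_range_aeval] at hgA
  obtain ⟨P, rfl⟩ := hgA
  have hdeg : (P %ₘ Q).natDegree < p := by
    refine (Polynomial.natDegree_modByMonic_lt P hQ ?_).trans_eq
      (Polynomial.natDegree_X_pow_sub_C)
    intro h
    have := congrArg Polynomial.natDegree h
    rw [Polynomial.natDegree_X_pow_sub_C, Polynomial.natDegree_one] at this
    exact hp.ne_zero this
  choose b hb using hLe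
  refine ⟨fun i => b ((P %ₘ Q).coeff i), ?_⟩
  have h2 : Polynomial.aeval t P = Polynomial.aeval t (P %ₘ Q) :=
    (Polynomial.aeval_modByMonic_eq_self_of_root hQt).symm
  change Polynomial.aeval t P = _
  rw [h2, Polynomial.aeval_eq_sum_range' hdeg]
  refine Finset.sum_congr rfl fun i _ => ?_
  rw [hb, Algebra.smul_def]

/-- The top coefficient of a polynomial in `t` of degree at most `m` is found by differentiating
`m` times. -/
theorem derivation_iterate_sum {δ : Derivation k K K} {t : K} (ht : δ t = 1) (m : ℕ)
    (c : ℕ → K) (hc : ∀ i, δ (c i) = 0) :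
    δ^[m] (∑ i ∈ Finset.range (m + 1), c i * t ^ i) = (m.factorial : K) * c m := by
  induction m generalizing c with
  | zero => simp
  | succ m ih =>
    have h : δ (∑ i ∈ Finset.range (m + 2), c i * t ^ i) =
        ∑ i ∈ Finset.range (m + 1), ((i + 1 : ℕ) * c (i + 1)) * t ^ i := by
      rw [Finset.sum_range_succ', map_add, map_sum]
      simp only [Derivation.leibniz, hc, ht, Derivation.leibniz_pow]
      simp [mul_comm, mul_assoc]
    rw [Function.iterate_succ_apply, h, ih]
    · rw [Nat.factorial_succ]; push_cast; ring
    · intro i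
      simp [hc]

/-- The constant is `(p - 1)! = -1`, by Wilson's theorem. -/
theorem derivation_iterate_char {δ : Derivation k K K} {t : K} (ht : δ t = 1) (f : ℕ → K) :
    δ^[p - 1] (∑ i ∈ Finset.range p, f i ^ p * t ^ i) = - f (p - 1) ^ p := by
  have hp : p.Prime := Fact.out
  have h := derivation_iterate_sum ht (p - 1) (fun i => f i ^ p)
    fun i => derivation_pow_char p δ (f i)
  rw [Nat.sub_add_cancel hp.one_le] at h
  rw [h]
  have h2 : (((p - 1).factorial : ℕ) : K) = -1 := by
    have := congrArg (ZMod.castHom (dvd_refl p) K) (ZMod.wilsons_lemma p)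
    rwa [map_natCast, map_neg, map_one] at this
  rw [h2, neg_one_mul]

open KaehlerDifferential (D)

/-- `η = f_{p-1} dt` for the given `t` with `ω = (f_0 ^ p + ⋯ + f_{p-1} ^ p t ^ (p-1)) dt`. -/
def IsCartierValueAt (k : Type u) [Field k] {K : Type u} [Field K] [Algebra k K] (p : ℕ)
    (t : K) (ω η : Ω[K⁄k]) : Prop :=
  ∃ f : ℕ → K, ω = (∑ i ∈ Finset.range p, f i ^ p * t ^ i) • D k K t ∧ η = f (p - 1) • D k K t

namespace IsCartierValueAt

variable {p}

omit [CharP K p] in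
theorem zero (t : K) : IsCartierValueAt k p t 0 0 := by
  have hp : p.Prime := Fact.out
  exact ⟨fun _ => 0, by simp [hp.ne_zero], by simp⟩

theorem add {t : K} {ω ω' η η' : Ω[K⁄k]} (h : IsCartierValueAt k p t ω η)
    (h' : IsCartierValueAt k p t ω' η') : IsCartierValueAt k p t (ω + ω') (η + η') := by
  obtain ⟨f, rfl, rfl⟩ := h
  obtain ⟨g, rfl, rfl⟩ := h'
  refine ⟨f + g, ?_, (add_smul _ _ _).symm⟩
  rw [← add_smul, ← Finset.sum_add_distrib]
  simp_rw [← add_mul, ← add_pow_char, Pi.add_apply]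

theorem sum {ι : Type*} {t : K} (s : Finset ι) {ω η : ι → Ω[K⁄k]}
    (h : ∀ i ∈ s, IsCartierValueAt k p t (ω i) (η i)) :
    IsCartierValueAt k p t (∑ i ∈ s, ω i) (∑ i ∈ s, η i) := by
  classical
  induction s using Finset.induction_on with
  | empty => simpa using zero t
  | insert a s ha ih =>
    rw [Finset.sum_insert ha, Finset.sum_insert ha]
    exact (h a (Finset.mem_insert_self _ _)).add
      (ih fun i hi => h i (Finset.mem_insert_of_mem hi))

omit [CharP K p] [Fact p.Prime] in
theorem pow_smul {t : K} {ω η : Ω[K⁄k]} (a : K) (h : IsCartierValueAt k p t ω η) :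
    IsCartierValueAt k p t (a ^ p • ω) (a • η) := by
  obtain ⟨f, rfl, rfl⟩ := h
  refine ⟨fun i => a * f i, ?_, smul_smul _ _ _⟩
  rw [smul_smul, Finset.mul_sum]
  simp_rw [mul_pow, mul_assoc]

/-- The value for a fixed `t` is unique, as `f_{p-1}` is recovered by applying `d / dt` repeatedly. -/
theorem unique {t : K} {δ : Derivation k K K} (hδ : δ t = 1) (ht : D k K t ≠ 0)
    {ω η η' : Ω[K⁄k]} (h : IsCartierValueAt k p t ω η) (h' : IsCartierValueAt k p t ω η') :
    η = η' := by
  obtain ⟨f, rfl, rfl⟩ := h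
  obtain ⟨g, hg, rfl⟩ := h'
  have h1 := congrArg (fun x => δ^[p - 1] x) (smul_left_injective K ht hg)
  simp only [derivation_iterate_char p hδ, neg_inj] at h1
  rw [frobenius_inj K p h1]

/-- Exact differentials have Cartier value zero. -/
theorem exact_zero [PerfectRing k p] {t : K} (ht : IsSeparating k t) (g : K) :
    IsCartierValueAt k p t (D k K g) 0 := by
  have hp : p.Prime := Fact.out
  obtain ⟨f, rfl⟩ := ht.exists_sum_pow p g
  refine ⟨fun i => ((i + 1 : ℕ) : K) * f (i + 1), ?_, ?_⟩
  · rw [map_sum]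
    simp only [Derivation.leibniz, derivation_pow_char, Derivation.leibniz_pow, smul_zero,
      add_zero, ← Nat.cast_smul_eq_nsmul K, smul_smul, ← Finset.sum_smul]
    congr 1
    obtain ⟨q, hq⟩ : ∃ q, p = q + 1 := ⟨p - 1, (Nat.sub_add_cancel hp.one_le).symm⟩
    have hcast : ∀ n : ℕ, (n : K) ^ p = n := fun n => by
      rw [← frobenius_def, map_natCast]
    have h0 : ((q + 1 : ℕ) : K) = 0 := by rw [← hq]; exact CharP.cast_eq_zero K p
    simp_rw [mul_pow, hcast]
    rw [hq, Finset.sum_range_succ', Finset.sum_range_succ, h0]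
    simp only [Nat.cast_zero, zero_mul, mul_zero, add_zero, Nat.add_sub_cancel]
    exact Finset.sum_congr rfl fun i _ => by ring
  · change 0 = (((p - 1 + 1 : ℕ) : K) * f (p - 1 + 1)) • D k K t
    rw [Nat.sub_add_cancel hp.one_le, CharP.cast_eq_zero, zero_mul, zero_smul]

omit [CharP K p] in
theorem pow_pred_smul_self (t : K) : IsCartierValueAt k p t (t ^ (p - 1) • D k K t) (D k K t) := by
  have hp : p.Prime := Fact.out
  refine ⟨fun i => if i = p - 1 then 1 else 0, ?_, by simp⟩
  congr 1
  rw [Finset.sum_eq_single (p - 1)]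
  · simp
  · intro i _ hi; simp [hi, hp.ne_zero]
  · intro h; exact absurd (Finset.mem_range.mpr (Nat.sub_lt hp.pos one_pos)) h

end IsCartierValueAt

omit [CharP K p] in
/-- In characteristic `p` the form `s ^ (p - 1) ds` is additive in `s` up to exact forms: the
difference is the differential of the reduction of `((a + b) ^ p - a ^ p - b ^ p) / p`. -/
theorem exists_pow_pred_smul_D_add (a b : K) : ∃ h : K,
    (a + b) ^ (p - 1) • D k K (a + b) =
      a ^ (p - 1) • D k K a + b ^ (p - 1) • D k K b + D k K h := by
  have hp : p.Prime := Fact.out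
  obtain ⟨q, hq⟩ : ∃ q, p = q + 1 := ⟨p - 1, (Nat.sub_add_cancel hp.one_le).symm⟩
  have hdvd : ∀ j ∈ Finset.range q, ∃ c : ℕ,
      (j + 1) * c = Nat.choose q j ∧ (q - j) * c = Nat.choose q (j + 1) := by
    intro j hj
    rw [Finset.mem_range] at hj
    obtain ⟨c, hc⟩ : p ∣ p.choose (j + 1) :=
      hp.dvd_choose_self (Nat.succ_ne_zero _) (by omega)
    refine ⟨c, ?_, ?_⟩
    · have := Nat.add_one_mul_choose_eq q j
      rw [← hq, hc] at this
      refine Nat.eq_of_mul_eq_mul_left hp.pos ?_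
      rw [this]; ring
    · have h1 := Nat.add_one_mul_choose_eq q (j + 1)
      have h2 := Nat.choose_succ_right_eq (q + 1) (j + 1)
      have h3 : q + 1 - (j + 1) = q - j := by omega
      rw [h3, ← hq, hc] at h2
      refine Nat.eq_of_mul_eq_mul_left hp.pos ?_
      have h4 : (q + 1) * q.choose (j + 1) = (q + 1).choose (j + 2) * (j + 2) := h1
      rw [hq] at *
      linarith
  -- `c j` is the binomial coefficient of `p` over `j + 1`, divided by `p`
  choose! c hc1 hc2 using hdvd
  refine ⟨∑ j ∈ Finset.range q, (c j : K) * (a ^ (j + 1) * b ^ (q - j)), ?_⟩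
  have hD : D k K (∑ j ∈ Finset.range q, (c j : K) * (a ^ (j + 1) * b ^ (q - j))) =
      (∑ j ∈ Finset.range q, a ^ j * b ^ (q - j) * (q.choose j : K)) • D k K a +
      (∑ j ∈ Finset.range q, a ^ (j + 1) * b ^ (q - (j + 1)) * (q.choose (j + 1) : K)) •
        D k K b := by
    rw [map_sum, Finset.sum_smul, Finset.sum_smul, ← Finset.sum_add_distrib]
    refine Finset.sum_congr rfl fun j hj => ?_
    have e1 : (q.choose j : K) = ((j + 1 : ℕ) : K) * (c j : K) := by
      rw [← Nat.cast_mul, hc1 j hj]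
    have e2 : (q.choose (j + 1) : K) = ((q - j : ℕ) : K) * (c j : K) := by
      rw [← Nat.cast_mul, hc2 j hj]
    have e3 : q - j - 1 = q - (j + 1) := by omega
    simp only [Derivation.leibniz, Derivation.leibniz_pow, Derivation.map_natCast, smul_zero,
      add_zero, ← Nat.cast_smul_eq_nsmul K, smul_add, smul_smul, e1, e2, Nat.add_sub_cancel, e3]
    rw [add_comm]
    congr 1 <;> congr 1 <;> ring
  have s1 : (a + b) ^ q =
      (∑ j ∈ Finset.range q, a ^ j * b ^ (q - j) * (q.choose j : K)) + a ^ q := by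
    rw [add_pow, Finset.sum_range_succ]; simp
  have s2 : (a + b) ^ q = (∑ j ∈ Finset.range q,
      a ^ (j + 1) * b ^ (q - (j + 1)) * (q.choose (j + 1) : K)) + b ^ q := by
    rw [add_pow, Finset.sum_range_succ']; simp
  rw [hD, show p - 1 = q by omega, map_add, smul_add]
  nth_rw 1 [s1]
  rw [s2, add_smul, add_smul]
  abel

variable {p}

/-- The identity `C(s ^ (p - 1) ds) = ds` holds for every `s`: both sides are additive in `s`, the
left side because exact forms have value zero, and for `s = f ^ p t ^ i` it is a computation. -/
theorem IsCartierValueAt.pow_pred_smul [PerfectRing k p] {t : K} (ht : IsSeparating k t) (s : K) :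
    IsCartierValueAt k p t (s ^ (p - 1) • D k K s) (D k K s) := by
  have hp : p.Prime := Fact.out
  obtain ⟨f, rfl⟩ := ht.exists_sum_pow p s
  refine Finset.sum_induction (fun i => f i ^ p * t ^ i)
    (fun s => IsCartierValueAt k p t (s ^ (p - 1) • D k K s) (D k K s)) ?_ ?_ ?_
  · intro a b ha hb
    obtain ⟨h, hh⟩ := exists_pow_pred_smul_D_add (k := k) p a b
    rw [hh, map_add, ← add_zero (D k K a + D k K b)]
    exact (ha.add hb).add (IsCartierValueAt.exact_zero ht h)
  · rw [map_zero, smul_zero]; exact .zero t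
  · intro i _
    rw [Derivation.leibniz, derivation_pow_char p, smul_zero, add_zero, Derivation.leibniz_pow]
    cases i with
    | zero => simpa using IsCartierValueAt.zero (k := k) (p := p) t
    | succ j =>
      have h := (IsCartierValueAt.pow_pred_smul_self (k := k) (p := p) t).pow_smul
        (((j + 1 : ℕ) : K) * (f (j + 1) ^ p * t ^ j))
      have hcast : ((j + 1 : ℕ) : K) ^ p = (j + 1 : ℕ) := by rw [← frobenius_def, map_natCast]
      obtain ⟨q, hq⟩ : ∃ q, p = q + 1 := ⟨p - 1, (Nat.sub_add_cancel hp.one_le).symm⟩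
      convert h using 1
      · simp only [← Nat.cast_smul_eq_nsmul K, smul_smul]
        congr 1
        rw [mul_pow _ _ p, hcast, hq, Nat.add_sub_cancel, Nat.add_sub_cancel]
        ring
      · simp only [← Nat.cast_smul_eq_nsmul K, smul_smul]
        congr 1
        rw [Nat.add_sub_cancel]
        ring

/-- The Cartier value does not depend on the choice of the separating element. -/
theorem IsCartierValueAt.change [PerfectRing k p] {s t : K} (ht : IsSeparating k t)
    {ω η : Ω[K⁄k]} (h : IsCartierValueAt k p s ω η) : IsCartierValueAt k p t ω η := by
  have hp : p.Prime := Fact.out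
  obtain ⟨f, rfl, rfl⟩ := h
  obtain ⟨q, hq⟩ : ∃ q, p = q + 1 := ⟨p - 1, (Nat.sub_add_cancel hp.one_le).symm⟩
  have hsum : ∑ i ∈ Finset.range p, f i ^ p * s ^ i =
      (∑ i ∈ Finset.range q, f i ^ p * s ^ i) + f q ^ p * s ^ q := by
    rw [hq, Finset.sum_range_succ]
  rw [hsum, add_smul, ← zero_add (f (p - 1) • _), show p - 1 = q by omega]
  refine IsCartierValueAt.add ?_ ?_
  · rw [Finset.sum_smul, ← Finset.sum_const_zero (s := Finset.range q)]
    refine IsCartierValueAt.sum _ fun i hi => ?_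
    rw [Finset.mem_range] at hi
    rw [mul_smul, ← smul_zero (f i)]
    refine IsCartierValueAt.pow_smul _ ?_
    -- `s ^ i ds` is exact for `i < p - 1`
    have hi0 : ((i + 1 : ℕ) : K) ≠ 0 := fun h0 =>
      absurd (Nat.le_of_dvd (Nat.succ_pos i) ((CharP.cast_eq_zero_iff K p _).mp h0)) (by omega)
    have h := (IsCartierValueAt.exact_zero (p := p) ht (s ^ (i + 1))).pow_smul
      (((i + 1 : ℕ) : K)⁻¹)
    have hcast : ((i + 1 : ℕ) : K) ^ p = (i + 1 : ℕ) := by rw [← frobenius_def, map_natCast]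
    rw [smul_zero, inv_pow, hcast, Derivation.leibniz_pow, ← Nat.cast_smul_eq_nsmul K, smul_smul,
      inv_mul_cancel₀ hi0, one_smul, Nat.add_sub_cancel] at h
    exact h
  · rw [mul_smul]
    have := IsCartierValueAt.pow_pred_smul ht s
    rw [show p - 1 = q by omega] at this
    exact this.pow_smul (f q)

end PthPowers

/-! ### The Cartier operator -/

section Cartier

open KaehlerDifferential (D)

variable {k : Type u} [Field k] {K : Type u} [Field K] [Algebra k K] {p : ℕ} [CharP K p]
  [Fact p.Prime] [PerfectRing k p] [Algebra.EssFiniteType k K]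

/-- The Cartier operator is computed by the `p`-expansion with respect to any separating `t`. -/
theorem IsCartierValueAt.cartier_eq (hΩ : Module.finrank K Ω[K⁄k] = 1) {t : K}
    (ht : D k K t ≠ 0) {ω η : Ω[K⁄k]} (h : IsCartierValueAt k p t ω η) : cartier k p ω = η := by
  have hs := isSeparating_of_D_ne_zero hΩ ht
  have hex : ∃ η, IsCartierValue k p ω η := by
    obtain ⟨f, hf⟩ := h
    exact ⟨η, t, hs, f, hf⟩
  rw [cartier, dif_pos hex]
  obtain ⟨s, hs', f, hf⟩ := hex.choose_spec
  obtain ⟨δ, hδ⟩ := exists_derivation hΩ ht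
  have hδt : δ t = 1 := by
    have := hδ t
    exact (smul_left_injective K ht (by simpa using this)).symm
  exact (IsCartierValueAt.change (s := s) hs ⟨f, hf⟩).unique hδt ht h

omit [Algebra.EssFiniteType k K] in
theorem exists_isCartierValueAt (hΩ : Module.finrank K Ω[K⁄k] = 1) {t : K}
    (ht : IsSeparating k t) (ω : Ω[K⁄k]) : ∃ η, IsCartierValueAt k p t ω η := by
  obtain ⟨g, rfl⟩ := exists_smul_D_of_D_ne_zero hΩ (ht.D_ne_zero hΩ) ω
  obtain ⟨f, rfl⟩ := ht.exists_sum_pow p g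
  exact ⟨_, f, rfl, rfl⟩

/-- The Cartier operator commutes with pullback along extensions in which a separating element
remains separating. -/
theorem cartier_diffMap {L : Type u} [Field L] [Algebra k L] [CharP L p]
    [Algebra.EssFiniteType k L] (hΩ : Module.finrank K Ω[K⁄k] = 1)
    (hΩL : Module.finrank L Ω[L⁄k] = 1) (φ : L →ₐ[k] K) {t : L} (ht : D k L t ≠ 0)
    (ht' : D k K (φ t) ≠ 0) (ω : Ω[L⁄k]) :
    cartier k p (diffMap φ ω) = diffMap φ (cartier k p ω) := by
  obtain ⟨η, hη⟩ := exists_isCartierValueAt (p := p) hΩL (isSeparating_of_D_ne_zero hΩL ht) ω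
  rw [hη.cartier_eq hΩL ht]
  refine IsCartierValueAt.cartier_eq hΩ ht' ?_
  obtain ⟨f, rfl, rfl⟩ := hη
  refine ⟨fun i => φ (f i), ?_, ?_⟩
  · simp [diffMap_smul, diffMap_D]
  · simp [diffMap_smul, diffMap_D]

end Cartier

end PinkDifferentials
end

/-! ### Local parameters and pole orders of differentials -/

noncomputable section

namespace PinkDifferentials

open KaehlerDifferential (D)

variable {k : Type u} [Field k] {K : Type u} [Field K]

/-- `a` is a unit of the subring `R` of the field `K`. -/
def IsUnitOf (R : Subring K) (a : K) : Prop := a ≠ 0 ∧ a ∈ R ∧ a⁻¹ ∈ R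

namespace IsUnitOf

variable {R : Subring K} {a b : K}

theorem mul (ha : IsUnitOf R a) (hb : IsUnitOf R b) : IsUnitOf R (a * b) :=
  ⟨mul_ne_zero ha.1 hb.1, R.mul_mem ha.2.1 hb.2.1, by
    rw [mul_inv]; exact R.mul_mem ha.2.2 hb.2.2⟩

theorem inv (ha : IsUnitOf R a) : IsUnitOf R a⁻¹ :=
  ⟨inv_ne_zero ha.1, ha.2.2, by rw [inv_inv]; exact ha.2.1⟩

theorem pow (ha : IsUnitOf R a) (n : ℕ) : IsUnitOf R (a ^ n) :=
  ⟨pow_ne_zero n ha.1, R.pow_mem ha.2.1 n, by rw [← inv_pow]; exact R.pow_mem ha.2.2 n⟩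

theorem zpow (ha : IsUnitOf R a) (n : ℤ) : IsUnitOf R (a ^ n) := by
  cases n with
  | ofNat n => rw [Int.ofNat_eq_natCast, zpow_natCast]; exact ha.pow n
  | negSucc n => rw [zpow_negSucc]; exact (ha.pow _).inv

theorem mul_mem_iff (ha : IsUnitOf R a) : a * b ∈ R ↔ b ∈ R := by
  refine ⟨fun h => ?_, fun h => R.mul_mem ha.2.1 h⟩
  have := R.mul_mem ha.2.2 h
  rwa [inv_mul_cancel_left₀ ha.1] at this

theorem map {L : Type u} [Field L] {S : Subring L} (φ : L →+* K) (hφ : ∀ a ∈ S, φ a ∈ R) {a : L}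
    (ha : IsUnitOf S a) : IsUnitOf R (φ a) :=
  ⟨(map_ne_zero φ).mpr ha.1, hφ _ ha.2.1, by rw [← map_inv₀]; exact hφ _ ha.2.2⟩

end IsUnitOf

variable [Algebra k K]

/-- The subring `R` of `K` is the local ring of a smooth `k`-rational point on a curve with function
field `K`, and `u` is a local parameter: `R` is a discrete valuation ring with fraction field `K`
and uniformizer `u`, and `du` generates the differentials of `R`. -/
structure IsLocalParameter (k : Type u) [Field k] {K : Type u} [Field K] [Algebra k K]
    (R : Subring K) (u : K) : Prop where
  algebraMap_mem : ∀ c : k, algebraMap k K c ∈ R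
  mem : u ∈ R
  inv_notMem : u⁻¹ ∉ R
  exists_zpow : ∀ f : K, f ≠ 0 → ∃ (n : ℤ) (a : K), IsUnitOf R a ∧ f = a * u ^ n
  exists_smul : ∀ g ∈ R, ∃ a ∈ R, D k K g = a • D k K u
  D_ne_zero : D k K u ≠ 0

/-- `ω` has a pole of order at most `m` with respect to the local parameter `u` of `R`. -/
def PoleLE (k : Type u) [Field k] {K : Type u} [Field K] [Algebra k K] (R : Subring K) (u : K)
    (m : ℕ) (ω : Ω[K⁄k]) : Prop := ∃ f, u ^ m * f ∈ R ∧ ω = f • D k K u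

namespace IsLocalParameter

variable {R : Subring K} {u : K} (h : IsLocalParameter k R u)

include h

theorem ne_zero : u ≠ 0 := fun h0 => h.inv_notMem (by rw [h0, inv_zero]; exact R.zero_mem)

theorem zpow_mem_iff (n : ℤ) : u ^ n ∈ R ↔ 0 ≤ n := by
  constructor
  · intro hn
    by_contra! hlt
    obtain ⟨m, rfl⟩ : ∃ m : ℕ, n = -(m + 1 : ℕ) := ⟨(-n - 1).toNat, by omega⟩
    apply h.inv_notMem
    have h1 := R.mul_mem (R.pow_mem h.mem m) hn
    rw [zpow_neg, zpow_natCast, pow_succ, mul_inv, mul_inv_cancel_left₀ (pow_ne_zero _ h.ne_zero)]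
      at h1
    exact h1
  · intro hn
    obtain ⟨m, rfl⟩ := Int.eq_ofNat_of_zero_le hn
    rw [zpow_natCast]
    exact R.pow_mem h.mem m

theorem unit_mul_zpow_mem_iff {a : K} (ha : IsUnitOf R a) (n : ℤ) : a * u ^ n ∈ R ↔ 0 ≤ n :=
  ha.mul_mem_iff.trans (h.zpow_mem_iff n)

/-- The ring `R` is closed under `n`-th roots, being integrally closed. -/
theorem mem_of_pow_mem {f : K} {n : ℕ} (hn : n ≠ 0) (hf : f ^ n ∈ R) : f ∈ R := by
  rcases eq_or_ne f 0 with rfl | hf0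
  · exact R.zero_mem
  obtain ⟨m, a, ha, rfl⟩ := h.exists_zpow f hf0
  rw [mul_pow, ← zpow_natCast (u ^ m), ← zpow_mul, h.unit_mul_zpow_mem_iff (ha.pow n)] at hf
  rw [h.unit_mul_zpow_mem_iff ha]
  exact nonneg_of_mul_nonneg_left hf (by exact_mod_cast Nat.pos_of_ne_zero hn)

theorem smul_D_injective {f g : K} (hfg : f • D k K u = g • D k K u) : f = g :=
  smul_left_injective K h.D_ne_zero hfg

theorem poleLE_smul_iff (m : ℕ) (f : K) : PoleLE k R u m (f • D k K u) ↔ u ^ m * f ∈ R := by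
  refine ⟨?_, fun hf => ⟨f, hf, rfl⟩⟩
  rintro ⟨g, hg, hfg⟩
  rwa [h.smul_D_injective hfg]

/-- The bound on the pole order is determined by the differentials that satisfy it. -/
theorem eq_of_poleLE_iff {m n : ℕ}
    (hmn : ∀ ω : Ω[K⁄k], PoleLE k R u m ω ↔ PoleLE k R u n ω) : m = n := by
  have key : ∀ m n : ℕ, (∀ ω : Ω[K⁄k], PoleLE k R u m ω → PoleLE k R u n ω) → m ≤ n := by
    intro m n hmn
    have h1 := hmn (u ^ (-m : ℤ) • D k K u)
    rw [h.poleLE_smul_iff, h.poleLE_smul_iff, ← zpow_natCast, ← zpow_natCast,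
      ← zpow_add₀ h.ne_zero, ← zpow_add₀ h.ne_zero, h.zpow_mem_iff, h.zpow_mem_iff] at h1
    omega
  exact le_antisymm (key m n fun ω => (hmn ω).mp) (key n m fun ω => (hmn ω).mpr)

/-- The Cartier operator preserves bounds on the pole order: with `δ = d / du` one has
`δ ^ (p - 1) (u ^ (p m) f) = - (u ^ m f_{p-1}) ^ p`, and `R` is stable under `δ` and integrally
closed. -/
theorem poleLE_cartier {p : ℕ} [CharP K p] [Fact p.Prime] [PerfectRing k p]
    [Algebra.EssFiniteType k K] (hΩ : Module.finrank K Ω[K⁄k] = 1) {m : ℕ} {ω : Ω[K⁄k]}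
    (hω : PoleLE k R u m ω) : PoleLE k R u m (cartier k p ω) := by
  have hp : p.Prime := Fact.out
  obtain ⟨g, hg, rfl⟩ := hω
  obtain ⟨f, rfl⟩ := (isSeparating_of_D_ne_zero hΩ h.D_ne_zero).exists_sum_pow p g
  have hc : IsCartierValueAt k p u ((∑ i ∈ Finset.range p, f i ^ p * u ^ i) • D k K u)
    (f (p - 1) • D k K u) := ⟨f, rfl, rfl⟩
  rw [hc.cartier_eq hΩ h.D_ne_zero, h.poleLE_smul_iff]
  obtain ⟨δ, hδ⟩ := exists_derivation hΩ h.D_ne_zero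
  have hδu : δ u = 1 := (h.smul_D_injective (by simpa using hδ u)).symm
  have hδR : ∀ n, ∀ a ∈ R, δ^[n] a ∈ R := by
    intro n
    induction n with
    | zero => exact fun a ha => ha
    | succ n ih =>
      intro a ha
      rw [Function.iterate_succ_apply]
      refine ih _ ?_
      obtain ⟨b, hb, hab⟩ := h.exists_smul a ha
      rw [hδ a] at hab
      rwa [h.smul_D_injective hab]
  have h1 : ∑ i ∈ Finset.range p, (u ^ m * f i) ^ p * u ^ i ∈ R := by
    have : ∑ i ∈ Finset.range p, (u ^ m * f i) ^ p * u ^ i =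
        (u ^ m) ^ (p - 1) * (u ^ m * ∑ i ∈ Finset.range p, f i ^ p * u ^ i) := by
      rw [← mul_assoc, ← pow_succ, Nat.sub_add_cancel hp.one_le, Finset.mul_sum]
      exact Finset.sum_congr rfl fun i _ => by rw [mul_pow, mul_assoc]
    rw [this]
    exact R.mul_mem (R.pow_mem (R.pow_mem h.mem _) _) hg
  have h2 := hδR (p - 1) _ h1
  rw [derivation_iterate_char p hδu (fun i => u ^ m * f i)] at h2
  exact h.mem_of_pow_mem hp.ne_zero (neg_mem_iff.mp h2)

/-- The ramification index `e` and the exponent `d` of the different, for an extension of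
discrete valuation rings: `d ≥ e - 1`, with strict inequality if and only if the
characteristic divides `e`. -/
theorem exists_ramification {L : Type u} [Field L] [Algebra k L] {S : Subring L} {v : L}
    (hv : IsLocalParameter k S v) (φ : L →ₐ[k] K) (hφv : (φ v)⁻¹ ∉ R)
    (hΩ : Module.finrank K Ω[K⁄k] = 1) (hφD : D k K (φ v) ≠ 0) :
    ∃ (e d : ℕ) (a b : K), IsUnitOf R a ∧ IsUnitOf R b ∧ φ v = a * u ^ e ∧
      diffMap φ (D k L v) = (b * u ^ d) • D k K u ∧ 0 < e ∧ e ≤ d + 1 ∧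
      (e ≤ d ↔ (e : K) = 0) := by
  obtain ⟨n, a, ha, hva⟩ := h.exists_zpow (φ v) ((map_ne_zero φ).mpr hv.ne_zero)
  have hn : 0 < n := by
    by_contra! hn
    apply hφv
    rw [hva, mul_inv, ← zpow_neg, h.unit_mul_zpow_mem_iff ha.inv]
    omega
  obtain ⟨e, rfl⟩ := Int.eq_ofNat_of_zero_le hn.le
  rw [zpow_natCast] at hva
  have he : 0 < e := by exact_mod_cast hn
  obtain ⟨c, hc⟩ := exists_smul_D_of_D_ne_zero hΩ h.D_ne_zero (D k K (φ v))
  have hc0 : c ≠ 0 := by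
    rintro rfl
    rw [zero_smul] at hc
    exact hφD hc
  obtain ⟨a', ha', haD⟩ := h.exists_smul a ha.2.1
  have hc1 : c = u ^ (e - 1) * (u * a' + e * a) := by
    refine h.smul_D_injective ?_
    rw [← hc, hva, Derivation.leibniz, Derivation.leibniz_pow, haD,
      ← Nat.cast_smul_eq_nsmul K, smul_smul, smul_smul, smul_smul, ← add_smul]
    congr 1
    obtain ⟨q, rfl⟩ : ∃ q, e = q + 1 := ⟨e - 1, by omega⟩
    rw [Nat.add_sub_cancel]
    ring
  obtain ⟨l, b, hb, hcb⟩ := h.exists_zpow c hc0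
  -- the cofactor `u a' + e a` lies in `R`, and it is a unit if and only if `e ≠ 0` in `K`
  have hR : u * a' + e * a ∈ R :=
    R.add_mem (R.mul_mem h.mem ha') (R.mul_mem (natCast_mem R e) ha.2.1)
  have hl : ((e : ℤ) - 1) ≤ l := by
    have h1 : u * a' + e * a = b * u ^ (l - (e - 1 : ℕ)) := by
      rw [zpow_sub₀ h.ne_zero, zpow_natCast, ← mul_div_assoc, ← hcb, hc1,
        mul_div_cancel_left₀ _ (pow_ne_zero _ h.ne_zero)]
    rw [h1, h.unit_mul_zpow_mem_iff hb] at hR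
    omega
  obtain ⟨d, rfl⟩ := Int.eq_ofNat_of_zero_le (show 0 ≤ l by omega)
  rw [zpow_natCast] at hcb
  refine ⟨e, d, a, b, ha, hb, hva, ?_, he, by omega, ?_, ?_⟩
  · rw [diffMap_D, hc, hcb]
  · intro hed
    by_contra he0
    have h1 : u * a' + e * a = u * (b * u ^ (d - e)) := by
      have h2 : u ^ (e - 1) * (u * a' + e * a) = u ^ (e - 1) * (u * (b * u ^ (d - e))) := by
        rw [← hc1, hcb]
        have : u ^ d = u ^ (e - 1) * (u * u ^ (d - e)) := by
          rw [← pow_succ', ← pow_add]; congr 1; omega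
        rw [this]; ring
      exact mul_left_cancel₀ (pow_ne_zero _ h.ne_zero) h2
    apply h.inv_notMem
    have h3 : u⁻¹ = (e : K)⁻¹ * a⁻¹ * (b * u ^ (d - e) - a') := by
      have h4 : (e : K) * a = u * (b * u ^ (d - e) - a') := by linear_combination h1
      have hu := h.ne_zero
      have ha0 := ha.1
      rw [← mul_inv, h4, mul_inv, mul_assoc, inv_mul_cancel₀, mul_one]
      intro h5
      rw [h5, mul_zero] at h4
      exact mul_ne_zero he0 ha0 h4
    rw [h3]
    refine R.mul_mem (R.mul_mem ?_ ha.2.2)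
      (R.sub_mem (R.mul_mem hb.2.1 (R.pow_mem h.mem _)) ha')
    have := h.algebraMap_mem (e : k)⁻¹
    rwa [map_inv₀, map_natCast] at this
  · intro he0
    have h1 : a' = b * u ^ ((d : ℤ) - e) := by
      rw [zpow_sub₀ h.ne_zero, zpow_natCast, zpow_natCast, ← mul_div_assoc, ← hcb, hc1, he0,
        zero_mul, add_zero, ← mul_assoc, ← pow_succ, Nat.sub_add_cancel he,
        mul_div_cancel_left₀ _ (pow_ne_zero _ h.ne_zero)]
    rw [h1, h.unit_mul_zpow_mem_iff hb] at ha'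
    omega

/-- The pullback of `h dv` has a pole of order at most `m` if and only if `h dv` has a pole of order
at most `⌊(d + m) / e⌋`. -/
theorem poleLE_diffMap_iff {L : Type u} [Field L] [Algebra k L] {S : Subring L} {v : L}
    (hv : IsLocalParameter k S v) (hΩL : Module.finrank L Ω[L⁄k] = 1) (φ : L →ₐ[k] K)
    (hφ : ∀ a ∈ S, φ a ∈ R) {e d : ℕ} {a b : K} (ha : IsUnitOf R a) (hb : IsUnitOf R b)
    (hva : φ v = a * u ^ e) (hdv : diffMap φ (D k L v) = (b * u ^ d) • D k K u) (he : 0 < e)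
    (m : ℕ) (ω : Ω[L⁄k]) :
    PoleLE k S v ((d + m) / e) ω ↔ PoleLE k R u m (diffMap φ ω) := by
  obtain ⟨f, rfl⟩ := exists_smul_D_of_D_ne_zero hΩL hv.D_ne_zero ω
  rw [hv.poleLE_smul_iff, diffMap_smul, hdv, smul_smul, h.poleLE_smul_iff]
  rcases eq_or_ne f 0 with rfl | hf0
  · simp [S.zero_mem, R.zero_mem]
  obtain ⟨n, c, hc, rfl⟩ := hv.exists_zpow f hf0
  have h1 : v ^ ((d + m) / e) * (c * v ^ n) = c * v ^ ((((d + m) / e : ℕ) : ℤ) + n) := by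
    rw [zpow_add₀ hv.ne_zero, zpow_natCast]; ring
  have h2 : u ^ m * (φ (c * v ^ n) * (b * u ^ d)) =
      (φ c * a ^ n * b) * u ^ ((m : ℤ) + e * n + d) := by
    rw [map_mul, map_zpow₀, hva, mul_zpow, zpow_add₀ h.ne_zero, zpow_add₀ h.ne_zero, zpow_natCast,
      zpow_natCast, zpow_mul, zpow_natCast]
    ring
  have hφc : IsUnitOf R (φ c) := hc.map φ.toRingHom hφ
  rw [h1, h2, hv.unit_mul_zpow_mem_iff hc,
    h.unit_mul_zpow_mem_iff ((hφc.mul (ha.zpow n)).mul hb)]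
  have h3 : -n ≤ ((d + m : ℕ) : ℤ) / (e : ℤ) ↔ -n * e ≤ ((d + m : ℕ) : ℤ) :=
    Int.le_ediv_iff_mul_le (by exact_mod_cast he)
  push_cast at h3 ⊢
  constructor
  · intro h4
    have := h3.mp (by linarith)
    linarith
  · intro h4
    have := h3.mpr (by linarith)
    linarith

/-- If the pullback of some `dt` with `t ∈ S` generates the differentials of `R`, then the
exponent of the different is zero. -/
theorem different_eq_zero {L : Type u} [Field L] [Algebra k L] {S : Subring L} {v : L}
    (hv : IsLocalParameter k S v) (φ : L →ₐ[k] K) (hφ : ∀ a ∈ S, φ a ∈ R) {d : ℕ} {b : K}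
    (hb : IsUnitOf R b) (hdv : diffMap φ (D k L v) = (b * u ^ d) • D k K u) {t : L}
    (ht : t ∈ S) (hgen : ∃ r ∈ R, D k K u = r • D k K (φ t)) : d = 0 := by
  obtain ⟨r, hr, hur⟩ := hgen
  obtain ⟨s, hs, hts⟩ := hv.exists_smul t ht
  have h1 : D k K (φ t) = (φ s * (b * u ^ d)) • D k K u := by
    rw [← diffMap_D, hts, diffMap_smul, hdv, smul_smul]
  have h2 : 1 = r * (φ s * (b * u ^ d)) := by
    refine h.smul_D_injective ?_
    rw [one_smul, mul_smul, ← h1, ← hur]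
  by_contra hd
  apply h.inv_notMem
  have h3 : u⁻¹ = r * (φ s * (b * u ^ (d - 1))) := by
    have h4 : u ^ d = u ^ (d - 1) * u := by rw [← pow_succ]; congr 1; omega
    rw [h4] at h2
    have hu := h.ne_zero
    rw [inv_eq_one_div, h2]
    field_simp
  rw [h3]
  exact R.mul_mem hr (R.mul_mem (hφ s hs) (R.mul_mem hb.2.1 (R.pow_mem h.mem _)))

end IsLocalParameter

end PinkDifferentials
end

/-! ### Local rings of smooth algebras of relative dimension one -/

noncomputable section

namespace PinkDifferentials

open KaehlerDifferential (D)
open IsLocalRing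

section Smooth

variable (k : Type u) [Field k] (A : Type u) [CommRing A] [Algebra k A]
  [Algebra.IsStandardSmoothOfRelativeDimension 1 k A]

theorem finrank_kaehlerDifferential_eq_one [IsDomain A] (K : Type u) [Field K] [Algebra k K]
    [Algebra A K] [IsScalarTower k A K] [IsFractionRing A K] :
    Module.finrank K Ω[K⁄k] = 1 := by
  have : Algebra.IsStandardSmooth k A :=
    Algebra.IsStandardSmoothOfRelativeDimension.isStandardSmooth 1
  have : Algebra.FormallyEtale A K := Algebra.FormallyEtale.of_isLocalization (nonZeroDivisors A)
  rw [← (KaehlerDifferential.tensorKaehlerEquivOfFormallyEtale k A K).finrank_eq,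
    Module.finrank_baseChange]
  have := Algebra.IsStandardSmoothOfRelativeDimension.rank_kaehlerDifferential (R := k) (S := A) 1
  rw [Module.finrank, this, Nat.cast_one, Cardinal.one_toNat]

theorem essFiniteType_of_isFractionRing (K : Type u) [Field K] [Algebra k K]
    [Algebra A K] [IsScalarTower k A K] [IsFractionRing A K] : Algebra.EssFiniteType k K := by
  have : Algebra.IsStandardSmooth k A :=
    Algebra.IsStandardSmoothOfRelativeDimension.isStandardSmooth 1
  have : Algebra.EssFiniteType A K := Algebra.EssFiniteType.of_isLocalization K (nonZeroDivisors A)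
  exact Algebra.EssFiniteType.comp k A K

theorem exists_span_singleton_kaehlerDifferential_eq_top [Nontrivial A] :
    ∃ ω : Ω[A⁄k], Submodule.span A {ω} = ⊤ := by
  have : Algebra.IsStandardSmooth k A :=
    Algebra.IsStandardSmoothOfRelativeDimension.isStandardSmooth 1
  have h := Algebra.IsStandardSmoothOfRelativeDimension.rank_kaehlerDifferential (R := k) (S := A) 1
  have h1 : Module.finrank A Ω[A⁄k] = 1 := by
    rw [Module.finrank, h, Nat.cast_one, Cardinal.one_toNat]
  let b := Module.finBasisOfFinrankEq A Ω[A⁄k] h1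
  refine ⟨b 0, ?_⟩
  rw [← b.span_eq]
  congr 1
  ext x
  simp [Fin.exists_fin_one, eq_comm]

omit [Algebra.IsStandardSmoothOfRelativeDimension 1 k A] in
theorem span_singleton_map_eq_top {ω : Ω[A⁄k]} (hω : Submodule.span A {ω} = ⊤) (M : Submonoid A)
    (O : Type u) [CommRing O] [Algebra k O] [Algebra A O] [IsScalarTower k A O]
    [IsLocalization M O] : Submodule.span O {KaehlerDifferential.map k k A O ω} = ⊤ := by
  rw [← Set.image_singleton]
  exact span_eq_top_of_isLocalizedModule O M (KaehlerDifferential.map k k A O) hω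

omit [Algebra.IsStandardSmoothOfRelativeDimension 1 k A] in
/-- A generator of the differentials of `A` generates the differentials of every localization. -/
theorem exists_D_algebraMap_eq_smul {ω : Ω[A⁄k]} (hω : Submodule.span A {ω} = ⊤)
    (M : Submonoid A) (O : Type u) [CommRing O] [Algebra k O] [Algebra A O] [IsScalarTower k A O]
    [IsLocalization M O] (K : Type u) [Field K] [Algebra k K] [Algebra A K] [IsScalarTower k A K]
    [Algebra O K] [IsScalarTower k O K] [IsScalarTower A O K] (g : O) :
    ∃ a : O, D k K (algebraMap O K g) = algebraMap O K a • KaehlerDifferential.map k k A K ω := by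
  have hmap : ∀ η : Ω[A⁄k], KaehlerDifferential.map k k O K (KaehlerDifferential.map k k A O η) =
      KaehlerDifferential.map k k A K η := by
    intro η
    have hη : η ∈ Submodule.span A (Set.range (D k A)) := by
      rw [KaehlerDifferential.span_range_derivation]; trivial
    induction hη using Submodule.span_induction with
    | mem x hx =>
      obtain ⟨a, rfl⟩ := hx
      simp only [KaehlerDifferential.map_D, ← IsScalarTower.algebraMap_apply A O K]
    | zero => simp only [map_zero]
    | add _ _ _ _ h1 h2 => simp only [map_add, h1, h2]
    | smul a x _ hx =>
      rw [(KaehlerDifferential.map k k A O).map_smul, (KaehlerDifferential.map k k A K).map_smul,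
        algebra_compatible_smul O a, (KaehlerDifferential.map k k O K).map_smul, hx,
        algebra_compatible_smul K (algebraMap A O a), ← IsScalarTower.algebraMap_apply A O K,
        ← algebra_compatible_smul K a]
  obtain ⟨a, ha⟩ := Submodule.mem_span_singleton.mp
    (span_singleton_map_eq_top k A hω M O ▸ Submodule.mem_top : D k O g ∈
      Submodule.span O {KaehlerDifferential.map k k A O ω})
  refine ⟨a, ?_⟩
  rw [← KaehlerDifferential.map_D k k O K, ← ha, map_smul, hmap, algebra_compatible_smul K a]

/-- Zariski's lemma for a local ring at a maximal ideal. -/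
theorem exists_sub_algebraMap_mem_maximalIdeal [IsAlgClosed k] (q : Ideal A) [q.IsMaximal]
    (O : Type u) [CommRing O] [IsLocalRing O] [Algebra k O] [Algebra A O] [IsScalarTower k A O]
    [IsLocalization.AtPrime O q] (g : O) : ∃ c : k, g - algebraMap k O c ∈ maximalIdeal O := by
  have : Algebra.IsStandardSmooth k A :=
    Algebra.IsStandardSmoothOfRelativeDimension.isStandardSmooth 1
  let := Ideal.Quotient.field q
  have : Module.Finite k (A ⧸ q) := finite_of_finite_type_of_isJacobsonRing k (A ⧸ q)
  have hbij : Function.Bijective (algebraMap k (A ⧸ q)) :=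
    IsAlgClosed.algebraMap_bijective_of_isIntegral
  obtain ⟨x, hx⟩ := (IsLocalization.AtPrime.equivQuotMaximalIdeal q O).surjective
    (Ideal.Quotient.mk _ g)
  obtain ⟨c, rfl⟩ := hbij.2 x
  refine ⟨c, ?_⟩
  rw [← Ideal.Quotient.mk_eq_mk_iff_sub_mem, ← hx, IsScalarTower.algebraMap_apply k A O,
    ← IsLocalization.AtPrime.equivQuotMaximalIdeal_apply_mk q O]
  rfl

end Smooth

section LocalRing

variable {k : Type u} [Field k] {O : Type u} [CommRing O] [IsLocalRing O] [Algebra k O]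

/-- The derivation `g ↦ g - g(x)` with values in the cotangent space exhibits the latter as
a quotient of the differentials, so that the maximal ideal is principal if the differentials
are cyclic. -/
theorem exists_maximalIdeal_eq_span [IsNoetherianRing O]
    (hres : ∀ g : O, ∃ c : k, g - algebraMap k O c ∈ maximalIdeal O)
    {ω : Ω[O⁄k]} (hω : Submodule.span O {ω} = ⊤) : ∃ u : O, maximalIdeal O = Ideal.span {u} := by
  have hbij : Function.Bijective (algebraMap k (ResidueField O)) := by
    refine ⟨(algebraMap k (ResidueField O)).injective, fun x => ?_⟩
    obtain ⟨g, rfl⟩ := residue_surjective x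
    obtain ⟨c, hc⟩ := hres g
    refine ⟨c, ?_⟩
    rw [← residue_eq_zero_iff, map_sub, sub_eq_zero] at hc
    rw [hc]; rfl
  -- evaluation at the closed point
  let σ : O →ₐ[k] k :=
    (AlgEquiv.ofBijective (Algebra.ofId k (ResidueField O)) hbij).symm.toAlgHom.comp
      (IsScalarTower.toAlgHom k O (ResidueField O))
  have hσres : ∀ g, algebraMap k (ResidueField O) (σ g) = residue O g := fun g =>
    (AlgEquiv.ofBijective (Algebra.ofId k (ResidueField O)) hbij).apply_symm_apply (residue O g)
  have hσ : ∀ g, g - algebraMap k O (σ g) ∈ maximalIdeal O := fun g => by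
    rw [← residue_eq_zero_iff, map_sub, sub_eq_zero, ← hσres g]
    rfl
  have hσ0 : ∀ g ∈ maximalIdeal O, σ g = 0 := fun g hg => by
    rw [← residue_eq_zero_iff, ← hσres g] at hg
    exact (map_eq_zero _).mp hg
  let l : O →ₗ[k] (maximalIdeal O) :=
    { toFun := fun g => ⟨g - algebraMap k O (σ g), hσ g⟩
      map_add' := fun a b => Subtype.ext (by
        change a + b - algebraMap k O (σ (a + b)) = a - _ + (b - _)
        rw [map_add, map_add]; abel)
      map_smul' := fun c a => Subtype.ext (by
        change c • a - algebraMap k O (σ (c • a)) = c • (a - _)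
        rw [map_smul, smul_sub, Algebra.smul_def c (algebraMap k O (σ a)), smul_eq_mul, map_mul]) }
  let δ : Derivation k O (maximalIdeal O).Cotangent := Derivation.mk'
    (((maximalIdeal O).toCotangent.restrictScalars k).comp l) fun a b => by
      change (maximalIdeal O).toCotangent (l (a * b)) =
        a • (maximalIdeal O).toCotangent (l b) + b • (maximalIdeal O).toCotangent (l a)
      rw [← (maximalIdeal O).toCotangent.map_smul a, ← (maximalIdeal O).toCotangent.map_smul b,
        ← map_add, Ideal.toCotangent_eq]
      have : ((l (a * b) : maximalIdeal O) : O) - (a • l b + b • l a : maximalIdeal O) =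
          -((l a : O) * (l b : O)) := by
        change a * b - algebraMap k O (σ (a * b)) -
          (a * (b - algebraMap k O (σ b)) + b * (a - algebraMap k O (σ a))) =
          -((a - algebraMap k O (σ a)) * (b - algebraMap k O (σ b)))
        rw [map_mul, map_mul]; ring
      rw [this, pow_two]
      exact neg_mem (Ideal.mul_mem_mul (l a).2 (l b).2)
  obtain ⟨u, hu⟩ := (maximalIdeal O).toCotangent_surjective (δ.liftKaehlerDifferential ω)
  refine ⟨u, le_antisymm ?_ ((Ideal.span_singleton_le_iff_mem _).mpr u.2)⟩
  refine Submodule.le_of_le_smul_of_le_jacobson_bot (I := maximalIdeal O)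
    (IsNoetherian.noetherian _) (IsLocalRing.maximalIdeal_le_jacobson _) fun g hg => ?_
  have h1 : (maximalIdeal O).toCotangent ⟨g, hg⟩ = δ.liftKaehlerDifferential (D k O g) := by
    rw [Derivation.liftKaehlerDifferential_comp_D]
    change _ = (maximalIdeal O).toCotangent (l g)
    congr 1
    exact Subtype.ext (by change g = g - _; rw [hσ0 g hg, map_zero, sub_zero])
  obtain ⟨a, ha⟩ := Submodule.mem_span_singleton.mp (hω ▸ Submodule.mem_top : D k O g ∈
    Submodule.span O {ω})
  rw [← ha, map_smul, ← hu, ← map_smul, Ideal.toCotangent_eq] at h1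
  have h2 : g = a * u + (g - a * u) := by ring
  rw [h2]
  refine Submodule.add_mem_sup (Ideal.mul_mem_left _ _ (Ideal.mem_span_singleton_self _)) ?_
  rw [smul_eq_mul, ← pow_two]
  exact h1

/-- By Nakayama's lemma, the differential of a uniformizer generates the differentials. -/
theorem exists_D_eq_smul_of_maximalIdeal_eq_span
    (hres : ∀ g : O, ∃ c : k, g - algebraMap k O c ∈ maximalIdeal O)
    {ω : Ω[O⁄k]} (hω : Submodule.span O {ω} = ⊤) {u : O} (hu : maximalIdeal O = Ideal.span {u})
    (g : O) : ∃ a : O, D k O g = a • D k O u := by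
  have h : (⊤ : Submodule O Ω[O⁄k]) ≤ Submodule.span O {D k O u} := by
    refine Submodule.le_of_le_smul_of_le_jacobson_bot (I := maximalIdeal O)
      ⟨{ω}, by simpa using hω⟩ (IsLocalRing.maximalIdeal_le_jacobson _) ?_
    rw [← KaehlerDifferential.span_range_derivation, Submodule.span_le]
    rintro _ ⟨g, rfl⟩
    obtain ⟨c, hc⟩ := hres g
    rw [hu, Ideal.mem_span_singleton] at hc
    obtain ⟨g', hg'⟩ := hc
    have h1 : D k O g = g' • D k O u + u • D k O g' := by
      rw [show g = algebraMap k O c + u * g' by rw [← hg']; ring, map_add,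
        Derivation.map_algebraMap, zero_add, Derivation.leibniz, add_comm]
    rw [h1]
    refine Submodule.add_mem_sup (Submodule.smul_mem _ _ (Submodule.mem_span_singleton_self _)) ?_
    refine Submodule.smul_mem_smul ?_ (Submodule.subset_span ⟨g', rfl⟩)
    rw [hu]
    exact Ideal.mem_span_singleton_self u
  obtain ⟨a, ha⟩ := Submodule.mem_span_singleton.mp (h (Submodule.mem_top (x := D k O g)))
  exact ⟨a, ha.symm⟩

variable {K : Type u} [Field K] [Algebra k K] [Algebra O K] [IsScalarTower k O K]
  [IsFractionRing O K]

/-- A noetherian local domain with cyclic differentials and principal maximal ideal is a discrete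
valuation ring whose uniformizers are local parameters. -/
theorem isLocalParameter_and_isDiscreteValuationRing [IsNoetherianRing O] [IsDomain O]
    (hres : ∀ g : O, ∃ c : k, g - algebraMap k O c ∈ maximalIdeal O)
    {ω : Ω[O⁄k]} (hω : Submodule.span O {ω} = ⊤) (hΩ : Module.finrank K Ω[K⁄k] = 1)
    {u : O} (hu : maximalIdeal O = Ideal.span {u}) :
    IsLocalParameter k (algebraMap O K).range (algebraMap O K u) ∧
      IsDiscreteValuationRing O := by
  have hD : ∀ g : O, ∃ a : O, D k K (algebraMap O K g) =
      algebraMap O K a • D k K (algebraMap O K u) := by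
    intro g
    obtain ⟨a, ha⟩ := exists_D_eq_smul_of_maximalIdeal_eq_span hres hω hu g
    refine ⟨a, ?_⟩
    have := congrArg (KaehlerDifferential.map k k O K) ha
    rwa [map_smul, KaehlerDifferential.map_D, KaehlerDifferential.map_D,
      algebra_compatible_smul K] at this
  have hDu : D k K (algebraMap O K u) ≠ 0 := by
    intro h0
    have h1 : lineSubfield k (⊥ : Submodule K Ω[K⁄k]) = ⊤ := by
      rw [eq_top_iff]
      intro f _
      obtain ⟨a, b, hb, rfl⟩ := IsFractionRing.div_surjective (A := O) f
      have h2 : ∀ a : O, algebraMap O K a ∈ lineSubfield k (⊥ : Submodule K Ω[K⁄k]) := by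
        intro a
        obtain ⟨c, hc⟩ := hD a
        rw [mem_lineSubfield, hc, h0, smul_zero]
        exact zero_mem _
      exact div_mem (h2 a) (h2 b)
    obtain ⟨t, ht⟩ := exists_D_ne_zero hΩ
    have h2 : t ∈ lineSubfield k (⊥ : Submodule K Ω[K⁄k]) := h1 ▸ IntermediateField.mem_top
    exact ht h2
  have hu0 : u ≠ 0 := by
    rintro rfl
    rw [map_zero, map_zero] at hDu
    exact hDu rfl
  have hum : u ∈ maximalIdeal O := by rw [hu]; exact Ideal.mem_span_singleton_self u
  have hfield : ¬ IsField O := fun hf => by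
    rw [isField_iff_maximalIdeal_eq] at hf
    rw [hf] at hum
    exact hu0 hum
  have hdvr : IsDiscreteValuationRing O := by
    have h1 := (IsDiscreteValuationRing.TFAE O hfield).out 0 4
    exact h1.mpr ⟨⟨u, hu⟩⟩
  have hirr : Irreducible u := (IsDiscreteValuationRing.irreducible_iff_uniformizer u).mpr hu
  refine ⟨⟨fun c => ⟨algebraMap k O c, (IsScalarTower.algebraMap_apply k O K c).symm⟩, ⟨u, rfl⟩,
    ?_, ?_, ?_, hDu⟩, hdvr⟩
  · rintro ⟨w, hw⟩
    have h1 : algebraMap O K (w * u) = algebraMap O K 1 := by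
      rw [map_mul, hw, map_one]
      exact inv_mul_cancel₀ ((map_ne_zero_iff _ (IsFractionRing.injective O K)).mpr hu0)
    exact hirr.not_isUnit (IsUnit.of_mul_eq_one_right _ (IsFractionRing.injective O K h1))
  · intro f hf
    obtain ⟨a, b, hb, rfl⟩ := IsFractionRing.div_surjective (A := O) f
    have hb0 : b ≠ 0 := nonZeroDivisors.ne_zero hb
    have ha0 : a ≠ 0 := by rintro rfl; rw [map_zero, zero_div] at hf; exact hf rfl
    obtain ⟨n, c, rfl⟩ := IsDiscreteValuationRing.eq_unit_mul_pow_irreducible ha0 hirr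
    obtain ⟨m, d, rfl⟩ := IsDiscreteValuationRing.eq_unit_mul_pow_irreducible hb0 hirr
    have hunit : ∀ c : Oˣ, IsUnitOf (algebraMap O K).range (algebraMap O K c) := fun c =>
      ⟨(c.isUnit.map (algebraMap O K)).ne_zero, ⟨c, rfl⟩, ⟨((c⁻¹ : Oˣ) : O), by
        rw [eq_comm, inv_eq_iff_eq_inv, eq_comm]
        exact inv_eq_of_mul_eq_one_left (by rw [← map_mul, Units.mul_inv, map_one])⟩⟩
    have huK : algebraMap O K u ≠ 0 := (map_ne_zero_iff _ (IsFractionRing.injective O K)).mpr hu0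
    refine ⟨n - m, _, (hunit c).mul (hunit d).inv, ?_⟩
    rw [map_mul, map_mul, map_pow, map_pow, zpow_sub₀ huK, zpow_natCast, zpow_natCast]
    have := (hunit d).1
    field_simp
  · rintro _ ⟨g, rfl⟩
    obtain ⟨a, ha⟩ := hD g
    exact ⟨_, ⟨a, rfl⟩, ha⟩

end LocalRing

end PinkDifferentials
end

/-! ### Local rings of curves -/

noncomputable section

namespace PinkDifferentials

open KaehlerDifferential (D)
open IsLocalRing

namespace Curve

variable {k : Type u} [Field k] (X : Curve k)

/-- The inclusion of the constants into the regular functions on `V`. -/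
def constOn (V : X.toScheme.Opens) : k →+* Γ(X.toScheme, V) :=
  (X.toScheme.presheaf.map (homOfLE (le_top : V ≤ ⊤)).op).hom.comp X.const

theorem germK_constOn (V : X.toScheme.Opens) (x : X.toScheme) (hx : x ∈ V) (c : k) :
    X.germK V x hx (X.constOn V c) = algebraMap k X.K c :=
  (X.germK_res (homOfLE (le_top : V ≤ ⊤)) x hx (X.const c)).trans
    (X.germK_eq ⊤ x _ trivial trivial _)

theorem exists_isAffineOpen_constOn_smooth (x : X.toScheme) :
    ∃ V : X.toScheme.Opens, IsAffineOpen V ∧ x ∈ V ∧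
      (X.constOn V).IsStandardSmoothOfRelativeDimension 1 := by
  obtain ⟨U, hU, V, hV, hxV, e, h⟩ :=
    SmoothOfRelativeDimension.exists_isStandardSmoothOfRelativeDimension (n := 1) (f := X.str) x
  refine ⟨V, hV, hxV, ?_⟩
  have hUtop : U = ⊤ := by
    ext y
    have : Subsingleton (Spec (CommRingCat.of k)) :=
      inferInstanceAs (Subsingleton (PrimeSpectrum k))
    simpa [Subsingleton.elim y (X.str x)] using e hxV
  subst hUtop
  let i : k ≃+* Γ(Spec (CommRingCat.of k), ⊤) :=
    (Scheme.ΓSpecIso (CommRingCat.of k)).symm.commRingCatIsoToRingEquiv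
  have h1 := h.comp (RingHom.IsStandardSmoothOfRelativeDimension.equiv i)
  exact h1

instance (V : X.toScheme.Opens) [Nonempty V] : Algebra Γ(X.toScheme, V) X.K :=
  inferInstanceAs (Algebra Γ(X.toScheme, V) X.toScheme.functionField)

theorem algebraMap_sections_eq (V : X.toScheme.Opens) [h : Nonempty V] (x : X.toScheme)
    (hx : x ∈ V) (a : Γ(X.toScheme, V)) : algebraMap Γ(X.toScheme, V) X.K a = X.germK V x hx a := by
  have hg : genericPoint X.toScheme ∈ V :=
    ((genericPoint_spec X.toScheme).mem_open_set_iff V.isOpen).mpr (by simpa using h)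
  rw [X.germK_eq V x (genericPoint X.toScheme) hx hg]
  exact (congrArg (fun f => CommRingCat.Hom.hom f a)
    (X.toScheme.presheaf.germ_stalkSpecializes hg
      ((genericPoint_spec X.toScheme).specializes trivial))).symm

/-- The local ring at `x` as an algebra over the constants. -/
@[reducible]
def stalkAlgebra (x : X.toScheme) : Algebra k (X.toScheme.presheaf.stalk x) :=
  ((X.toScheme.presheaf.germ ⊤ x trivial).hom.comp X.const).toAlgebra

instance (x : X.toScheme) : Algebra (X.toScheme.presheaf.stalk x) X.K :=
  inferInstanceAs (Algebra (X.toScheme.presheaf.stalk x) X.toScheme.functionField)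

instance (x : X.toScheme) : IsFractionRing (X.toScheme.presheaf.stalk x) X.K :=
  inferInstanceAs (IsFractionRing (X.toScheme.presheaf.stalk x) X.toScheme.functionField)

theorem toK_injective (x : X.toScheme) : Function.Injective (X.toK x) :=
  IsFractionRing.injective (X.toScheme.presheaf.stalk x) X.K

theorem germK_injective (V : X.toScheme.Opens) (x : X.toScheme) (hx : x ∈ V) :
    Function.Injective (X.germK V x hx) :=
  (X.toK_injective x).comp (germ_injective_of_isIntegral X.toScheme x hx)

/-- The function field is the fraction field of a standard smooth algebra of relative
dimension one. -/
theorem finrank_merDiff_and_essFiniteType :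
    Module.finrank X.K X.MerDiff = 1 ∧ Algebra.EssFiniteType k X.K := by
  obtain ⟨V, hV, hx, hs⟩ := X.exists_isAffineOpen_constOn_smooth (genericPoint X.toScheme)
  have : Nonempty V := ⟨⟨_, hx⟩⟩
  let : Algebra k Γ(X.toScheme, V) := (X.constOn V).toAlgebra
  have : IsScalarTower k Γ(X.toScheme, V) X.K := IsScalarTower.of_algebraMap_eq fun c =>
    ((X.algebraMap_sections_eq V _ hx _).trans (X.germK_constOn V _ hx c)).symm
  have : IsFractionRing Γ(X.toScheme, V) X.K :=
    functionField_isFractionRing_of_isAffineOpen X.toScheme V hV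
  have : Algebra.IsStandardSmoothOfRelativeDimension 1 k Γ(X.toScheme, V) := hs
  exact ⟨finrank_kaehlerDifferential_eq_one k Γ(X.toScheme, V) X.K,
    essFiniteType_of_isFractionRing k Γ(X.toScheme, V) X.K⟩

theorem finrank_merDiff : Module.finrank X.K X.MerDiff = 1 :=
  X.finrank_merDiff_and_essFiniteType.1

instance : Algebra.EssFiniteType k X.K := X.finrank_merDiff_and_essFiniteType.2

instance : IsLocallyNoetherian X.toScheme :=
  LocallyOfFiniteType.isLocallyNoetherian X.str

theorem isScalarTower_stalk (x : X.toScheme) :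
    letI := X.stalkAlgebra x
    IsScalarTower k (X.toScheme.presheaf.stalk x) X.K :=
  letI := X.stalkAlgebra x
  IsScalarTower.of_algebraMap_eq fun c => X.germK_eq ⊤ _ x trivial trivial (X.const c)

theorem isScalarTower_sections_stalk (V : X.toScheme.Opens) (x : X.toScheme) (hxV : x ∈ V) :
    letI := X.stalkAlgebra x
    letI := (X.constOn V).toAlgebra
    letI := (X.toScheme.presheaf.germ V x hxV).hom.toAlgebra
    IsScalarTower k Γ(X.toScheme, V) (X.toScheme.presheaf.stalk x) :=
  letI := X.stalkAlgebra x
  letI := (X.constOn V).toAlgebra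
  letI := (X.toScheme.presheaf.germ V x hxV).hom.toAlgebra
  IsScalarTower.of_algebraMap_eq fun c =>
    (TopCat.Presheaf.germ_res_apply X.toScheme.presheaf (homOfLE (le_top : V ≤ ⊤)) x hxV
      (X.const c)).symm

/-- Locally around the generic point, the differentials of all local rings are generated by
a single differential. -/
theorem exists_generator : ∃ V : X.toScheme.Opens, genericPoint X.toScheme ∈ V ∧
    ∃ ω : X.MerDiff, ∀ x ∈ V, ∀ g : X.toScheme.presheaf.stalk x,
      ∃ a, D k X.K (X.toK x g) = X.toK x a • ω := by
  obtain ⟨V, hV, hη, hs⟩ := X.exists_isAffineOpen_constOn_smooth (genericPoint X.toScheme)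
  have : Nonempty V := ⟨⟨_, hη⟩⟩
  let : Algebra k Γ(X.toScheme, V) := (X.constOn V).toAlgebra
  have : Algebra.IsStandardSmoothOfRelativeDimension 1 k Γ(X.toScheme, V) := hs
  have : IsScalarTower k Γ(X.toScheme, V) X.K := IsScalarTower.of_algebraMap_eq fun c =>
    ((X.algebraMap_sections_eq V _ hη _).trans (X.germK_constOn V _ hη c)).symm
  obtain ⟨ω₀, hω₀⟩ := exists_span_singleton_kaehlerDifferential_eq_top k Γ(X.toScheme, V)
  refine ⟨V, hη, KaehlerDifferential.map k k Γ(X.toScheme, V) X.K ω₀, fun x hxV g => ?_⟩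
  let : Algebra k (X.toScheme.presheaf.stalk x) := X.stalkAlgebra x
  let : Algebra Γ(X.toScheme, V) (X.toScheme.presheaf.stalk x) :=
    (X.toScheme.presheaf.germ V x hxV).hom.toAlgebra
  have : IsScalarTower k Γ(X.toScheme, V) (X.toScheme.presheaf.stalk x) :=
    X.isScalarTower_sections_stalk V x hxV
  have : IsScalarTower k (X.toScheme.presheaf.stalk x) X.K := X.isScalarTower_stalk x
  have : IsScalarTower Γ(X.toScheme, V) (X.toScheme.presheaf.stalk x) X.K :=
    IsScalarTower.of_algebraMap_eq fun a => X.algebraMap_sections_eq V x hxV a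
  have hloc : IsLocalization.AtPrime (X.toScheme.presheaf.stalk x)
    (hV.primeIdealOf ⟨x, hxV⟩).asIdeal := hV.isLocalization_stalk ⟨x, hxV⟩
  exact exists_D_algebraMap_eq_smul k Γ(X.toScheme, V) hω₀
    (hV.primeIdealOf ⟨x, hxV⟩).asIdeal.primeCompl (X.toScheme.presheaf.stalk x) X.K g

/-- The local ring at a closed point of a curve is a discrete valuation ring, and every uniformizer
is a local parameter. -/
theorem isLocalParameter_and_isDiscreteValuationRing [IsAlgClosed k] (x : X.toScheme)
    (hx : IsClosed {x}) :
    (∃ u, maximalIdeal (X.toScheme.presheaf.stalk x) = Ideal.span {u}) ∧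
    (∀ u, maximalIdeal (X.toScheme.presheaf.stalk x) = Ideal.span {u} →
      IsLocalParameter k (X.toK x).range (X.toK x u)) ∧
    IsDiscreteValuationRing (X.toScheme.presheaf.stalk x) := by
  obtain ⟨V, hV, hxV, hs⟩ := X.exists_isAffineOpen_constOn_smooth x
  have : Nonempty V := ⟨⟨x, hxV⟩⟩
  let : Algebra k Γ(X.toScheme, V) := (X.constOn V).toAlgebra
  let : Algebra k (X.toScheme.presheaf.stalk x) := X.stalkAlgebra x
  let : Algebra Γ(X.toScheme, V) (X.toScheme.presheaf.stalk x) :=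
    (X.toScheme.presheaf.germ V x hxV).hom.toAlgebra
  have : IsScalarTower k Γ(X.toScheme, V) (X.toScheme.presheaf.stalk x) :=
    X.isScalarTower_sections_stalk V x hxV
  have : IsScalarTower k (X.toScheme.presheaf.stalk x) X.K := X.isScalarTower_stalk x
  have : Algebra.IsStandardSmoothOfRelativeDimension 1 k Γ(X.toScheme, V) := hs
  have hloc : IsLocalization.AtPrime (X.toScheme.presheaf.stalk x)
    (hV.primeIdealOf ⟨x, hxV⟩).asIdeal := hV.isLocalization_stalk ⟨x, hxV⟩
  have hmax : (hV.primeIdealOf ⟨x, hxV⟩).asIdeal.IsMaximal :=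
    hV.primeIdealOf_isMaximal_of_isClosed ⟨x, hxV⟩ hx
  obtain ⟨ω₀, hω₀⟩ := exists_span_singleton_kaehlerDifferential_eq_top k Γ(X.toScheme, V)
  have hω := span_singleton_map_eq_top k Γ(X.toScheme, V) hω₀
    (hV.primeIdealOf ⟨x, hxV⟩).asIdeal.primeCompl (X.toScheme.presheaf.stalk x)
  have hres := exists_sub_algebraMap_mem_maximalIdeal k Γ(X.toScheme, V)
    (hV.primeIdealOf ⟨x, hxV⟩).asIdeal (X.toScheme.presheaf.stalk x)
  have key := fun u hu => PinkDifferentials.isLocalParameter_and_isDiscreteValuationRing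
    (K := X.K) hres hω X.finrank_merDiff (u := u) hu
  obtain ⟨u, hu⟩ := exists_maximalIdeal_eq_span hres hω
  exact ⟨⟨u, hu⟩, fun u hu => (key u hu).1, (key u hu).2⟩

end Curve

end PinkDifferentials
end

/-! ### Points of curves -/

noncomputable section

namespace PinkDifferentials

open KaehlerDifferential (D)
open IsLocalRing

namespace Curve

variable {k : Type u} [Field k]

section Points

variable (X : Curve k)

theorem exists_germK_eq (f : X.K) : ∃ (U : X.toScheme.Opens) (h : genericPoint X.toScheme ∈ U)
    (a : Γ(X.toScheme, U)), X.germK U (genericPoint X.toScheme) h a = f := by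
  obtain ⟨U, h, a, rfl⟩ := X.toScheme.presheaf.exists_germ_eq f
  exact ⟨U, h, a, congrArg (fun φ => CommRingCat.Hom.hom φ a)
    (X.toScheme.presheaf.germ_stalkSpecializes h
      ((genericPoint_spec X.toScheme).specializes trivial))⟩

theorem toK_genericPoint_surjective : Function.Surjective (X.toK (genericPoint X.toScheme)) := by
  intro f
  obtain ⟨U, h, a, rfl⟩ := X.exists_germK_eq f
  exact ⟨_, rfl⟩

theorem not_isClosed_genericPoint [IsAlgClosed k] : ¬ IsClosed {genericPoint X.toScheme} := by
  intro h
  obtain ⟨⟨u, hu⟩, hp, -⟩ := X.isLocalParameter_and_isDiscreteValuationRing _ h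
  obtain ⟨a, ha⟩ := X.toK_genericPoint_surjective (X.toK _ u)⁻¹
  exact (hp u hu).inv_notMem ⟨a, ha⟩

instance : CompactSpace X.toScheme :=
  QuasiCompact.compactSpace_of_compactSpace X.str

theorem isClosed_or_eq_genericPoint [IsAlgClosed k] (x : X.toScheme) :
    IsClosed {x} ∨ x = genericPoint X.toScheme := by
  rw [or_iff_not_imp_left]
  intro hx
  obtain ⟨z, hz, hzc⟩ := (isClosed_closure (s := {x})).exists_closed_singleton
    ⟨x, subset_closure rfl⟩
  have hspec : x ⤳ z := by rwa [specializes_iff_mem_closure]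
  have hxz : x ≠ z := by rintro rfl; exact hx hzc
  have hgz : genericPoint X.toScheme ≠ z := by
    intro h
    exact X.not_isClosed_genericPoint (h ▸ hzc)
  have hdvr := (X.isLocalParameter_and_isDiscreteValuationRing z hzc).2.2
  -- the local ring at `z` has only one prime ideal besides the maximal ideal
  have key : ∀ y : X.toScheme, y ⤳ z → y ≠ z →
      y = X.toScheme.fromSpecStalk z (⊥ : PrimeSpectrum (X.toScheme.presheaf.stalk z)) := by
    intro y hy hyz
    have : y ∈ Set.range (X.toScheme.fromSpecStalk z) := by
      rw [Scheme.range_fromSpecStalk]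
      exact hy
    obtain ⟨q, rfl⟩ := this
    congr 1
    by_contra hq
    apply hyz
    have hq0 : q.asIdeal ≠ ⊥ := fun h0 => hq (PrimeSpectrum.ext h0)
    have hmax : q.asIdeal = maximalIdeal _ :=
      IsLocalRing.eq_maximalIdeal (q.isPrime.isMaximal hq0)
    have : q = closedPoint _ := PrimeSpectrum.ext hmax
    rw [this]
    exact Scheme.fromSpecStalk_closedPoint
  rw [key x hspec hxz, key _ ((genericPoint_spec X.toScheme).specializes trivial) hgz]

/-- A nonempty open subset has a finite complement: the finitely many irreducible components of the
complement do not contain the generic point, hence are closed points. -/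
theorem finite_compl [IsAlgClosed k] (U : X.toScheme.Opens)
    (hU : genericPoint X.toScheme ∈ U) : (U : Set X.toScheme)ᶜ.Finite := by
  have : IsNoetherian X.toScheme := {}
  obtain ⟨S, hS, hS', hU'⟩ := NoetherianSpace.exists_finite_set_isClosed_irreducible
    U.isOpen.isClosed_compl
  rw [hU'.2]
  refine Set.Finite.sUnion hS fun T hT => ?_
  obtain ⟨x, hx⟩ := QuasiSober.sober (hU'.1 T hT) (hS' T hT)
  have hxT : x ∈ T := hx.mem
  have hxU : x ∈ (U : Set X.toScheme)ᶜ := by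
    rw [hU'.2]; exact ⟨T, hT, hxT⟩
  rcases X.isClosed_or_eq_genericPoint x with h | rfl
  · have : T = {x} := (show closure {x} = T from hx).symm.trans h.closure_eq
    rw [this]; exact Set.finite_singleton x
  · exact absurd hU hxU

/-- At a closed point, the stalk of `Ω_X(D)` consists of the differentials with a pole of order at
most the multiplicity of `D`. -/
theorem mem_omegaStalk_iff [IsAlgClosed k] (D' : EffectiveDivisor X) {x : X.toScheme}
    (hx : IsClosed {x}) {u : X.toScheme.presheaf.stalk x} (hu : maximalIdeal _ = Ideal.span {u})
    (ω : X.MerDiff) :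
    ω ∈ X.omegaStalk D' x ↔ PoleLE k (X.toK x).range (X.toK x u) (D'.mult x) ω := by
  have h := (X.isLocalParameter_and_isDiscreteValuationRing x hx).2.1 u hu
  have hpole : ∀ f, f ∈ X.polesLE D' x ↔ X.toK x u ^ D'.mult x * f ∈ (X.toK x).range := by
    intro f
    have hpow : maximalIdeal (X.toScheme.presheaf.stalk x) ^ D'.mult x =
        Ideal.span {u ^ D'.mult x} := by rw [hu, Ideal.span_singleton_pow]
    constructor
    · intro hf
      rw [← map_pow]
      exact hf _ (hpow ▸ Ideal.mem_span_singleton_self _)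
    · intro hf a ha
      rw [hpow, Ideal.mem_span_singleton] at ha
      obtain ⟨c, rfl⟩ := ha
      rw [map_mul, map_pow, mul_comm (X.toK x u ^ _), mul_assoc]
      exact (X.toK x).range.mul_mem ⟨c, rfl⟩ hf
  constructor
  · intro hω
    induction hω using AddSubgroup.closure_induction with
    | mem ω hω =>
      obtain ⟨f, hf, g, rfl⟩ := hω
      obtain ⟨a, ha, hg⟩ := h.exists_smul _ ⟨g, rfl⟩
      rw [hg, smul_smul, h.poleLE_smul_iff, ← mul_assoc]
      exact (X.toK x).range.mul_mem ((hpole f).mp hf) ha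
    | zero => exact ⟨0, by simp, (zero_smul _ _).symm⟩
    | add _ _ _ _ h1 h2 =>
      obtain ⟨f, hf, rfl⟩ := h1
      obtain ⟨g, hg, rfl⟩ := h2
      exact ⟨f + g, by rw [mul_add]; exact add_mem hf hg, (add_smul _ _ _).symm⟩
    | neg _ _ h1 =>
      obtain ⟨f, hf, rfl⟩ := h1
      exact ⟨-f, by rw [mul_neg]; exact neg_mem hf, (neg_smul _ _).symm⟩
  · rintro ⟨f, hf, rfl⟩
    exact AddSubgroup.subset_closure ⟨f, (hpole f).mpr hf, u, rfl⟩

theorem omegaStalk_genericPoint [IsAlgClosed k] (D' : EffectiveDivisor X) (ω : X.MerDiff) :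
    ω ∈ X.omegaStalk D' (genericPoint X.toScheme) := by
  have h0 : D'.mult (genericPoint X.toScheme) = 0 := by
    by_contra h
    exact X.not_isClosed_genericPoint (D'.isClosed _ h)
  obtain ⟨t, ht⟩ := exists_D_ne_zero X.finrank_merDiff
  obtain ⟨f, rfl⟩ := exists_smul_D_of_D_ne_zero X.finrank_merDiff ht ω
  obtain ⟨g, rfl⟩ := X.toK_genericPoint_surjective t
  exact AddSubgroup.subset_closure ⟨f, fun a _ => X.toK_genericPoint_surjective _, g, rfl⟩

end Points

section Pullback

theorem pull_genericPoint_mem {X Y : Curve k} (f : X.toOver ⟶ Y.toOver) [IsDominant f.left]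
    {U : Y.toScheme.Opens} (hU : genericPoint Y.toScheme ∈ U) :
    f.left (genericPoint X.toScheme) ∈ U :=
  (map_genericPoint_specializes f).mem_open U.isOpen hU

theorem pull_comp {X Y Z : Curve k} (f : X.toOver ⟶ Y.toOver) (g : Y.toOver ⟶ Z.toOver)
    [IsDominant f.left] [IsDominant g.left] [IsDominant (f ≫ g).left] (a : Z.K) :
    pull (f ≫ g) a = pull f (pull g a) := by
  obtain ⟨U, hU, s, rfl⟩ := Z.exists_germK_eq a
  have h1 := pull_genericPoint_mem g hU
  have h2 : f.left (genericPoint X.toScheme) ∈ g.left ⁻¹ᵁ U := pull_genericPoint_mem f h1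
  have h3 := pull_genericPoint_mem (f ≫ g) hU
  have e1 : pull g (Z.germK U _ hU s) = Y.germK (g.left ⁻¹ᵁ U) _ h2 (g.left.app U s) :=
    (congrArg (pull g) (Z.germK_eq U _ _ hU h1 s)).trans
      ((pullRing_germK g U _ h1 s).trans (Y.germK_eq _ _ _ _ _ _))
  have e2 : pull f (Y.germK (g.left ⁻¹ᵁ U) _ h2 (g.left.app U s)) =
      X.germK (f.left ⁻¹ᵁ g.left ⁻¹ᵁ U) _ h2 (f.left.app _ (g.left.app U s)) :=
    pullRing_germK f _ _ h2 _
  have e3 : pull (f ≫ g) (Z.germK U _ hU s) =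
      X.germK ((f ≫ g).left ⁻¹ᵁ U) _ h3 ((f ≫ g).left.app U s) :=
    (congrArg (pull (f ≫ g)) (Z.germK_eq U _ _ hU h3 s)).trans (pullRing_germK (f ≫ g) U _ h3 s)
  rw [e1, e2, e3]
  exact congrArg (X.germK (f.left ⁻¹ᵁ g.left ⁻¹ᵁ U) _ h2)
    (ConcreteCategory.congr_hom (Scheme.Hom.comp_app f.left g.left U) s)

theorem pull_id (X : Curve k) [IsDominant (𝟙 X.toOver : X.toOver ⟶ X.toOver).left] (a : X.K) :
    pull (𝟙 X.toOver) a = a := by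
  obtain ⟨U, hU, s, rfl⟩ := X.exists_germK_eq a
  exact pullRing_germK (𝟙 X.toOver) U _ hU s

end Pullback

end Curve

theorem diffMap_diffMap {k : Type u} [Field k] {L K M : Type u} [Field L] [Field K] [Field M]
    [Algebra k L] [Algebra k K] [Algebra k M] (φ : K →ₐ[k] M) (ψ : L →ₐ[k] K) (χ : L →ₐ[k] M)
    (h : ∀ a, χ a = φ (ψ a)) (ω : Ω[L⁄k]) : diffMap φ (diffMap ψ ω) = diffMap χ ω := by
  have hω : ω ∈ Submodule.span L (Set.range (D k L)) := by
    rw [KaehlerDifferential.span_range_derivation]; trivial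
  induction hω using Submodule.span_induction with
  | mem x hx => obtain ⟨a, rfl⟩ := hx; rw [diffMap_D, diffMap_D, diffMap_D, h]
  | zero => simp
  | add _ _ _ _ h1 h2 => rw [map_add, map_add, map_add, h1, h2]
  | smul a x _ hx => rw [diffMap_smul, diffMap_smul, diffMap_smul, hx, h]

theorem diffMap_eq_self {k : Type u} [Field k] {K : Type u} [Field K] [Algebra k K]
    (φ : K →ₐ[k] K) (h : ∀ a, φ a = a) (ω : Ω[K⁄k]) : diffMap φ ω = ω := by
  have hω : ω ∈ Submodule.span K (Set.range (D k K)) := by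
    rw [KaehlerDifferential.span_range_derivation]; trivial
  induction hω using Submodule.span_induction with
  | mem x hx => obtain ⟨a, rfl⟩ := hx; rw [diffMap_D, h]
  | zero => simp
  | add _ _ _ _ h1 h2 => rw [map_add, h1, h2]
  | smul a x _ hx => rw [diffMap_smul, hx, h]

namespace Curve

variable {k : Type u} [Field k]

theorem pullDiff_comp {X Y Z : Curve k} (f : X.toOver ⟶ Y.toOver) (g : Y.toOver ⟶ Z.toOver)
    [IsDominant f.left] [IsDominant g.left] [IsDominant (f ≫ g).left] (ω : Z.MerDiff) :
    pullDiff (f ≫ g) ω = pullDiff f (pullDiff g ω) :=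
  (diffMap_diffMap (pull f) (pull g) (pull (f ≫ g)) (pull_comp f g) ω).symm

theorem pullDiff_id (X : Curve k) [IsDominant (𝟙 X.toOver : X.toOver ⟶ X.toOver).left]
    (ω : X.MerDiff) : pullDiff (𝟙 X.toOver) ω = ω :=
  diffMap_eq_self _ X.pull_id ω

theorem pullDiff_congr {X Y : Curve k} {f g : X.toOver ⟶ Y.toOver} (h : f = g)
    [IsDominant f.left] [IsDominant g.left] (ω : Y.MerDiff) : pullDiff f ω = pullDiff g ω := by
  subst h; rfl

theorem pull_congr {X Y : Curve k} {f g : X.toOver ⟶ Y.toOver} (h : f = g)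
    [IsDominant f.left] [IsDominant g.left] (a : Y.K) : pull f a = pull g a := by
  subst h; rfl

instance {X : Curve k} (g : Aut X.toOver) : IsIso g.hom.left :=
  ((Over.forget _).mapIso g).isIso_hom

theorem pullDiff_mem_omegaStalk {X : Curve k} (g : Aut X.toOver) {D' D'' : EffectiveDivisor X}
    {x : X.toScheme} (h : D''.mult x = D'.mult (g.hom.left x)) {ω : X.MerDiff}
    (hω : ω ∈ X.omegaStalk D' (g.hom.left x)) : pullDiff g.hom ω ∈ X.omegaStalk D'' x := by
  induction hω using AddSubgroup.closure_induction with
  | mem ω hω =>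
    obtain ⟨f, hf, s, rfl⟩ := hω
    refine AddSubgroup.subset_closure ⟨pull g.hom f, fun a ha => ?_, g.hom.left.stalkMap x s, ?_⟩
    · let e : X.toScheme.presheaf.stalk (g.hom.left x) ≃+* X.toScheme.presheaf.stalk x :=
        (asIso (g.hom.left.stalkMap x)).commRingCatIsoToRingEquiv
      have hmax : maximalIdeal (X.toScheme.presheaf.stalk x) =
          (maximalIdeal (X.toScheme.presheaf.stalk (g.hom.left x))).map e.toRingHom :=
        (IsLocalRing.map_ringEquiv_maximalIdeal e).symm
      rw [h, hmax, ← Ideal.map_pow] at ha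
      obtain ⟨b, hb, rfl⟩ := (Ideal.mem_map_iff_of_surjective _ e.surjective).mp ha
      obtain ⟨c, hc⟩ := hf b hb
      refine ⟨g.hom.left.stalkMap x c, ?_⟩
      rw [← pullRing_toK, hc, map_mul, pullRing_toK]
      rfl
    · rw [← pullRing_toK]
      exact (diffMap_smul (pull g.hom) f _).trans (congrArg _ (diffMap_D (pull g.hom) _))
  | zero => rw [map_zero]; exact zero_mem _
  | add _ _ _ _ h1 h2 => rw [map_add]; exact add_mem h1 h2
  | neg _ _ h1 => rw [map_neg]; exact neg_mem h1

theorem aut_inv_hom_apply {X : Curve k} (g : Aut X.toOver) (x : X.toScheme) :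
    g⁻¹.hom.left (g.hom.left x) = x := by
  have : g.hom ≫ g⁻¹.hom = 𝟙 _ := g.hom_inv_id
  exact congrArg (fun f : X.toOver ⟶ X.toOver => f.left x) this

theorem pullDiff_aut_inv {X : Curve k} (g : Aut X.toOver) (ω : X.MerDiff) :
    pullDiff g⁻¹.hom (pullDiff g.hom ω) = ω := by
  have h : g⁻¹.hom ≫ g.hom = 𝟙 _ := g.inv_hom_id
  have : IsDominant (𝟙 X.toOver : X.toOver ⟶ X.toOver).left :=
    inferInstanceAs (IsDominant (1 : Aut X.toOver).hom.left)
  have : IsDominant (g⁻¹.hom ≫ g.hom).left := by rw [h]; infer_instance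
  rw [← pullDiff_comp, pullDiff_congr h, pullDiff_id]

theorem pullDiff_mem_omegaStalk_iff {X : Curve k} (g : Aut X.toOver) {D' D'' : EffectiveDivisor X}
    {x : X.toScheme} (h : D''.mult x = D'.mult (g.hom.left x)) {ω : X.MerDiff} :
    pullDiff g.hom ω ∈ X.omegaStalk D'' x ↔ ω ∈ X.omegaStalk D' (g.hom.left x) := by
  refine ⟨fun hω => ?_, pullDiff_mem_omegaStalk g h⟩
  rw [← pullDiff_aut_inv g ω]
  have hx := aut_inv_hom_apply g x
  exact pullDiff_mem_omegaStalk g⁻¹ (by rw [hx, h]) (hx.symm ▸ hω)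

end Curve

end PinkDifferentials
end

/-! ### Function fields and differentials of a quotient curve -/

noncomputable section

namespace PinkDifferentials

open KaehlerDifferential (D)
open IsLocalRing Curve

variable {k : Type u} [Field k] {X Y : Curve k}

theorem Curve.map_genericPoint (f : X.toOver ⟶ Y.toOver) [IsDominant f.left] :
    f.left (genericPoint X.toScheme) = genericPoint Y.toScheme :=
  ((map_genericPoint_specializes f).antisymm
    ((genericPoint_spec Y.toScheme).specializes trivial)).eq

theorem Curve.pull_injective (f : X.toOver ⟶ Y.toOver) [IsDominant f.left] :
    Function.Injective (pull f) :=
  (pull f).toRingHom.injective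

/-- By Artin's theorem a field is separable over the fixed field of a finite group, so that the
differentials of fixed elements span all differentials. -/
theorem eq_top_of_D_fixed_mem {K : Type u} [Field K] [Algebra k K] (G : Type*) [Group G] [Finite G]
    [MulSemiringAction G K] (hG : ∀ (g : G) (c : k), g • algebraMap k K c = algebraMap k K c)
    (W : Submodule K Ω[K⁄k]) (hW : ∀ a : K, (∀ g : G, g • a = a) → D k K a ∈ W) : W = ⊤ := by
  let E := FixedPoints.subfield G K
  let : Algebra k E := ((algebraMap k K).codRestrict E fun c g => hG g c).toAlgebra
  have : IsScalarTower k E K := IsScalarTower.of_algebraMap_eq fun c => rfl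
  have : Algebra.FormallyUnramified E K := Algebra.FormallyUnramified.of_isSeparable E K
  exact eq_top_of_D_algebraMap_mem (L := E) W fun a => hW a a.2

/-- The action of a group of automorphisms of a curve on its function field, by pullback along
inverses. -/
@[reducible]
def functionFieldAction (N : Subgroup (Aut X.toOver)) : MulSemiringAction N X.K where
  smul n f := pull n⁻¹.1.hom f
  one_smul f := by
    have hid : IsDominant (𝟙 X.toOver : X.toOver ⟶ X.toOver).left :=
      inferInstanceAs (IsDominant (1 : Aut X.toOver).hom.left)
    change pull (1 : N)⁻¹.1.hom f = f
    have h : (1 : N)⁻¹.1.hom = 𝟙 X.toOver := by rw [inv_one]; rfl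
    rw [pull_congr h, pull_id]
  mul_smul m n f := by
    change pull (m * n)⁻¹.1.hom f = pull m⁻¹.1.hom (pull n⁻¹.1.hom f)
    have h : (m * n)⁻¹.1.hom = m⁻¹.1.hom ≫ n⁻¹.1.hom := by rw [mul_inv_rev]; rfl
    have : IsDominant (m⁻¹.1.hom ≫ n⁻¹.1.hom).left :=
      inferInstanceAs (IsDominant (n⁻¹.1 * m⁻¹.1 : Aut X.toOver).hom.left)
    rw [pull_congr h, pull_comp]
  smul_zero n := map_zero (pull n⁻¹.1.hom)
  smul_add n := map_add (pull n⁻¹.1.hom)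
  smul_one n := map_one (pull n⁻¹.1.hom)
  smul_mul n := map_mul (pull n⁻¹.1.hom)

namespace IsQuotient

variable {N : Subgroup (Aut X.toOver)} {π : X.toOver ⟶ Y.toOver} (hπ : IsQuotient N π)

include hπ

theorem isClosed_singleton_iff [IsAlgClosed k] (x : X.toScheme) :
    IsClosed {π.left x} ↔ IsClosed {x} := by
  have := hπ.isDominant
  constructor
  · intro h
    rcases X.isClosed_or_eq_genericPoint x with hx | rfl
    · exact hx
    · rw [map_genericPoint] at h
      exact absurd h Y.not_isClosed_genericPoint
  · intro h
    rcases Y.isClosed_or_eq_genericPoint (π.left x) with hx | hx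
    · exact hx
    · rw [← map_genericPoint π] at hx
      obtain ⟨n, -, hn⟩ := hπ.orbit _ _ hx.symm
      rw [map_genericPoint] at hn
      exact absurd (hn ▸ h) X.not_isClosed_genericPoint

theorem pull_pull_aut [IsDominant π.left] {n : Aut X.toOver} (hn : n ∈ N) (a : Y.K) :
    pull n.hom (pull π a) = pull π a := by
  have : IsDominant (n.hom ≫ π).left := by rw [hπ.invariant n hn]; infer_instance
  rw [← pull_comp, pull_congr (hπ.invariant n hn)]

theorem pullDiff_pullDiff_aut [IsDominant π.left] {n : Aut X.toOver} (hn : n ∈ N)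
    (ω : Y.MerDiff) : Curve.pullDiff n.hom (Curve.pullDiff π ω) = Curve.pullDiff π ω := by
  have : IsDominant (n.hom ≫ π).left := by rw [hπ.invariant n hn]; infer_instance
  rw [← pullDiff_comp, pullDiff_congr (hπ.invariant n hn)]

/-- An `N`-invariant open neighbourhood of the generic point inside a given one, as the preimage
of an open subset of the quotient. -/
theorem exists_preimage_le [Finite N] (U : X.toScheme.Opens)
    (hU : genericPoint X.toScheme ∈ U) :
    ∃ V : Y.toScheme.Opens, π.left (genericPoint X.toScheme) ∈ V ∧ π.left ⁻¹ᵁ V ≤ U := by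
  let U' : Set X.toScheme := ⋂ n : N, (n.1.hom.left ⁻¹ᵁ U : X.toScheme.Opens)
  have hU' : IsOpen U' := isOpen_iInter_of_finite fun n => (n.1.hom.left ⁻¹ᵁ U).isOpen
  have hsat : π.left ⁻¹' (π.left '' U') = U' := by
    refine Set.Subset.antisymm ?_ (Set.subset_preimage_image _ _)
    rintro x ⟨x', hx', hxx'⟩
    obtain ⟨n, hn, rfl⟩ := hπ.orbit x' x hxx'
    rw [Set.mem_iInter] at hx' ⊢
    intro m
    exact hx' ⟨m.1 * n, N.mul_mem m.2 hn⟩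
  refine ⟨⟨π.left '' U', hπ.isQuotientMap.isOpen_preimage.mp (hsat.symm ▸ hU')⟩,
    ⟨_, Set.mem_iInter.mpr fun n => pull_genericPoint_mem n.1.hom hU, rfl⟩, ?_⟩
  intro x hx
  have hx' : x ∈ U' := hsat ▸ hx
  exact Set.mem_iInter.mp hx' ⟨1, N.one_mem⟩

/-- The function field of the quotient is the field of invariants: an invariant function is regular
on an invariant open set, where it descends by the definition of a quotient. -/
theorem exists_pull_eq [Finite N] [IsDominant π.left] (f : X.K)
    (hf : ∀ n ∈ N, pull n.hom f = f) : ∃ g : Y.K, pull π g = f := by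
  obtain ⟨U, hU, a, rfl⟩ := X.exists_germK_eq f
  obtain ⟨V, hV, hVU⟩ := hπ.exists_preimage_le U hU
  let W := π.left ⁻¹ᵁ V
  let a' : Γ(X.toScheme, W) := X.toScheme.presheaf.map (homOfLE hVU).op a
  have ha' : X.germK W _ hV a' = X.germK U _ hU a := X.germK_res (homOfLE hVU) _ hV a
  obtain ⟨b, hb⟩ := hπ.surjective V a' fun n hn h => by
    apply X.germK_injective W _ hV
    have hnη : n.hom.left (genericPoint X.toScheme) ∈ W := h hV
    have h1 : X.germK W _ hV (n.hom.left.appLE W W h a') =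
        X.germK (n.hom.left ⁻¹ᵁ W) _ hnη (n.hom.left.app W a') :=
      X.germK_res (homOfLE h) _ hV (n.hom.left.app W a')
    have h2 := hf n hn
    rw [← ha'] at h2
    refine h1.trans ((pullRing_germK n.hom W _ hnη a').symm.trans ?_)
    rw [X.germK_eq W _ _ hnη hV]
    exact h2
  refine ⟨Y.germK V _ hV b, ?_⟩
  rw [← ha', ← hb]
  exact pullRing_germK π V _ hV b

/-- The differentials of functions on the quotient span the differentials of `X`. -/
theorem eq_top_of_D_pull_mem [Finite N] [IsDominant π.left] (W : Submodule X.K X.MerDiff)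
    (hW : ∀ a : Y.K, D k X.K (pull π a) ∈ W) : W = ⊤ := by
  let := functionFieldAction N
  refine eq_top_of_D_fixed_mem N (fun n c => (pull n⁻¹.1.hom).commutes c) W fun a ha => ?_
  obtain ⟨g, rfl⟩ := hπ.exists_pull_eq a fun n hn => by
    have h1 : pull (⟨n⁻¹, N.inv_mem hn⟩ : N)⁻¹.1.hom a = a := ha ⟨n⁻¹, N.inv_mem hn⟩
    have h2 : (⟨n⁻¹, N.inv_mem hn⟩ : N)⁻¹.1 = n := by rw [Subgroup.coe_inv, inv_inv]
    rwa [pull_congr (congrArg Iso.hom h2)] at h1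
  exact hW g

theorem D_pull_ne_zero [Finite N] [IsDominant π.left] {t : Y.K} (ht : D k Y.K t ≠ 0) :
    D k X.K (pull π t) ≠ 0 := by
  intro h0
  have h := hπ.eq_top_of_D_pull_mem ⊥ fun a => by
    obtain ⟨c, hc⟩ := exists_smul_D_of_D_ne_zero Y.finrank_merDiff ht (D k Y.K a)
    rw [← diffMap_D, hc, diffMap_smul, diffMap_D, h0, smul_zero]
    exact zero_mem _
  obtain ⟨s, hs⟩ := exists_D_ne_zero X.finrank_merDiff
  exact hs ((Submodule.mem_bot _).mp (h ▸ Submodule.mem_top))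

theorem pullDiff_injective [Finite N] [IsDominant π.left] :
    Function.Injective (Curve.pullDiff π) := by
  obtain ⟨t, ht⟩ := exists_D_ne_zero Y.finrank_merDiff
  rw [injective_iff_map_eq_zero]
  intro ω hω
  obtain ⟨f, rfl⟩ := exists_smul_D_of_D_ne_zero Y.finrank_merDiff ht ω
  change diffMap (pull π) _ = 0 at hω
  rw [diffMap_smul, diffMap_D, smul_eq_zero] at hω
  rcases hω with h | h
  · rw [(map_eq_zero_iff _ (pull_injective π)).mp h, zero_smul]
  · exact absurd h (hπ.D_pull_ne_zero ht)

/-- Every invariant meromorphic differential is the pullback of a differential on the quotient. -/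
theorem exists_pullDiff_eq [Finite N] [IsDominant π.left] (ω : X.MerDiff)
    (hω : ∀ n ∈ N, Curve.pullDiff n.hom ω = ω) : ∃ η : Y.MerDiff, Curve.pullDiff π η = ω := by
  obtain ⟨t, ht⟩ := exists_D_ne_zero Y.finrank_merDiff
  have ht' := hπ.D_pull_ne_zero ht
  obtain ⟨f, rfl⟩ := exists_smul_D_of_D_ne_zero X.finrank_merDiff ht' ω
  obtain ⟨g, rfl⟩ := hπ.exists_pull_eq f fun n hn => by
    have h := hω n hn
    change diffMap (pull n.hom) _ = _ at h
    rw [diffMap_smul, diffMap_D, hπ.pull_pull_aut hn] at h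
    exact smul_left_injective _ ht' h
  exact ⟨g • D k Y.K t, (diffMap_smul _ _ _).trans (by rw [diffMap_D])⟩

theorem cartier_pullDiff [Finite N] [IsDominant π.left] [IsAlgClosed k] (p : ℕ) [Fact p.Prime]
    [CharP k p] (ω : Y.MerDiff) :
    cartier k p (Curve.pullDiff π ω) = Curve.pullDiff π (cartier k p ω) := by
  have : CharP X.K p := charP_of_injective_algebraMap (algebraMap k X.K).injective p
  have : CharP Y.K p := charP_of_injective_algebraMap (algebraMap k Y.K).injective p
  obtain ⟨t, ht⟩ := exists_D_ne_zero Y.finrank_merDiff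
  exact cartier_diffMap X.finrank_merDiff Y.finrank_merDiff (pull π) ht (hπ.D_pull_ne_zero ht) ω

end IsQuotient

theorem Curve.pull_mem_range_toK (f : X.toOver ⟶ Y.toOver) [IsDominant f.left] (x : X.toScheme) :
    ∀ a ∈ (Y.toK (f.left x)).range, pull f a ∈ (X.toK x).range := by
  rintro _ ⟨s, rfl⟩
  exact ⟨f.left.stalkMap x s, (pullRing_toK f x s).symm⟩

/-- If a uniformizer at `π(x)` is a unit times the `e`-th power of a uniformizer at `x`, then `e` is
the ramification index. -/
theorem ramificationIndex_eq (π : X.toOver ⟶ Y.toOver) [IsDominant π.left]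
    {x : X.toScheme} [IsDiscreteValuationRing (X.toScheme.presheaf.stalk x)]
    {u : X.toScheme.presheaf.stalk x} (hu : maximalIdeal _ = Ideal.span {u})
    {v : Y.toScheme.presheaf.stalk (π.left x)} (hv : maximalIdeal _ = Ideal.span {v})
    {e : ℕ} {a : X.K} (ha : IsUnitOf (X.toK x).range a)
    (h : pull π (Y.toK _ v) = a * X.toK x u ^ e) : ramificationIndex π x = e := by
  let : Algebra (Y.toScheme.presheaf.stalk (π.left x)) (X.toScheme.presheaf.stalk x) :=
    (π.left.stalkMap x).hom.toAlgebra
  obtain ⟨ha0, ⟨c, rfl⟩, ⟨d, hd⟩⟩ := ha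
  have hirr : Irreducible u := (IsDiscreteValuationRing.irreducible_iff_uniformizer u).mpr hu
  have hcd : d * c = 1 := by
    apply X.toK_injective x
    rw [map_mul, hd, map_one]
    exact inv_mul_cancel₀ ha0
  have hmap : algebraMap (Y.toScheme.presheaf.stalk (π.left x)) (X.toScheme.presheaf.stalk x) v =
      c * u ^ e := by
    apply X.toK_injective x
    rw [map_mul, map_pow, ← h]
    exact (pullRing_toK π x v).symm
  have hmapI : (maximalIdeal (Y.toScheme.presheaf.stalk (π.left x))).map
      (algebraMap _ (X.toScheme.presheaf.stalk x)) =
        maximalIdeal (X.toScheme.presheaf.stalk x) ^ e := by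
    rw [hv, Ideal.map_span, Set.image_singleton, hmap, hu, Ideal.span_singleton_pow,
      Ideal.span_singleton_mul_left_unit (IsUnit.of_mul_eq_one_right d hcd)]
  have hlies : (maximalIdeal (X.toScheme.presheaf.stalk x)).LiesOver
      (maximalIdeal (Y.toScheme.presheaf.stalk (π.left x))) := by
    have : IsLocalHom (algebraMap (Y.toScheme.presheaf.stalk (π.left x))
      (X.toScheme.presheaf.stalk x)) := inferInstanceAs (IsLocalHom (π.left.stalkMap x).hom)
    exact ⟨(IsLocalRing.maximalIdeal_comap _).symm⟩
  have h1 := Ideal.ramificationIdx'_eq_ramificationIdx'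
    (maximalIdeal (Y.toScheme.presheaf.stalk (π.left x)))
    (maximalIdeal (X.toScheme.presheaf.stalk x))
    (by rw [hmapI]; exact pow_ne_zero _ (IsDiscreteValuationRing.not_a_field _))
  refine h1.symm.trans (Ideal.ramificationIdx'_spec hmapI.le ?_)
  rw [hmapI, hu, Ideal.span_singleton_pow, Ideal.span_singleton_pow,
    Ideal.span_singleton_le_span_singleton]
  rintro ⟨w, hw⟩
  rw [pow_succ, mul_assoc] at hw
  have := mul_left_cancel₀ (pow_ne_zero e hirr.ne_zero) ((mul_one _).trans hw)
  exact hirr.not_isUnit (IsUnit.of_mul_eq_one w this.symm)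

end PinkDifferentials
end

/-! ### The pole divisor on the quotient -/

noncomputable section

namespace PinkDifferentials

open KaehlerDifferential (D)
open IsLocalRing Curve

variable {k : Type u} [Field k] [IsAlgClosed k] {X Y : Curve k}

omit [IsAlgClosed k] in
theorem Curve.pullDiff_comm (π : X.toOver ⟶ Y.toOver) [IsDominant π.left] {g : Aut X.toOver}
    {h : Aut Y.toOver} (hgh : g.hom ≫ π = π ≫ h.hom) (ω : Y.MerDiff) :
    Curve.pullDiff g.hom (Curve.pullDiff π ω) = Curve.pullDiff π (Curve.pullDiff h.hom ω) := by
  have : IsDominant (g.hom ≫ π).left := inferInstanceAs (IsDominant (g.hom.left ≫ π.left))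
  have : IsDominant (π ≫ h.hom).left := inferInstanceAs (IsDominant (π.left ≫ h.hom.left))
  exact (Curve.pullDiff_comp g.hom π ω).symm.trans
    ((Curve.pullDiff_congr hgh ω).trans (Curve.pullDiff_comp π h.hom ω))

namespace IsQuotient

variable {N : Subgroup (Aut X.toOver)} {π : X.toOver ⟶ Y.toOver} (hπ : IsQuotient N π)
  [Finite N] [IsDominant π.left] (p : ℕ) [CharP k p]

include hπ

/-- Local shape of the quotient map at a closed point `x`: with local parameters `u` at `x` and `v`
at `π(x)`, the pullback of `v` is a unit times `u ^ e` for the ramification index `e`, and the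
pullback of `dv` is a unit times `u ^ d du`. -/
theorem exists_local_form {x : X.toScheme} (hx : IsClosed {x}) :
    ∃ (u : X.toScheme.presheaf.stalk x) (v : Y.toScheme.presheaf.stalk (π.left x)) (d : ℕ)
      (a b : X.K), maximalIdeal _ = Ideal.span {u} ∧ maximalIdeal _ = Ideal.span {v} ∧
      IsLocalParameter k (X.toK x).range (X.toK x u) ∧
      IsLocalParameter k (Y.toK (π.left x)).range (Y.toK (π.left x) v) ∧
      IsUnitOf (X.toK x).range a ∧ IsUnitOf (X.toK x).range b ∧
      pull π (Y.toK _ v) = a * X.toK x u ^ ramificationIndex π x ∧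
      Curve.pullDiff π (D k Y.K (Y.toK _ v)) = (b * X.toK x u ^ d) • D k X.K (X.toK x u) ∧
      0 < ramificationIndex π x ∧ ramificationIndex π x ≤ d + 1 ∧
      (ramificationIndex π x ≤ d ↔ p ∣ ramificationIndex π x) := by
  obtain ⟨⟨u, hu⟩, hpu, hdvr⟩ := X.isLocalParameter_and_isDiscreteValuationRing x hx
  obtain ⟨⟨v, hv⟩, hpv, -⟩ := Y.isLocalParameter_and_isDiscreteValuationRing (π.left x)
    ((hπ.isClosed_singleton_iff x).mpr hx)
  have hlu := hpu u hu
  have hlv := hpv v hv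
  have hinv : (pull π (Y.toK _ v))⁻¹ ∉ (X.toK x).range := by
    rintro ⟨w, hw⟩
    let v' : X.toScheme.presheaf.stalk x := π.left.stalkMap x v
    have hv' : X.toK x v' = pull π (Y.toK _ v) := (pullRing_toK π x v).symm
    have h1 : X.toK x (w * v') = X.toK x 1 := by
      rw [map_mul, hw, hv', map_one]
      exact inv_mul_cancel₀ ((map_ne_zero (pull π)).mpr hlv.ne_zero)
    have h2 : IsUnit v' :=
      IsUnit.of_mul_eq_one_right _ (X.toK_injective x h1)
    have h3 : IsUnit v := (isUnit_map_iff (π.left.stalkMap x).hom v).mp h2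
    have h4 : v ∈ maximalIdeal (Y.toScheme.presheaf.stalk (π.left x)) := by
      rw [hv]; exact Ideal.mem_span_singleton_self v
    exact h4 h3
  obtain ⟨e, d, a, b, ha, hb, hva, hdv, he, hed, hed'⟩ := hlu.exists_ramification hlv (pull π) hinv
    X.finrank_merDiff (hπ.D_pull_ne_zero hlv.D_ne_zero)
  have hram : ramificationIndex π x = e := ramificationIndex_eq π hu hv ha hva
  subst hram
  have : CharP X.K p := charP_of_injective_algebraMap (algebraMap k X.K).injective p
  exact ⟨u, v, d, a, b, hu, hv, hlu, hlv, ha, hb, hva, hdv, he, hed,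
    hed'.trans (CharP.cast_eq_zero_iff X.K p _)⟩

/-- The multiplicity `m = ⌊(d + D(x)) / e⌋` that a divisor on the quotient must have at `π(x)` for
its differentials there to be those whose pullback lies in the stalk of `Ω_X(D)` at `x`. It is
nonzero if and only if `D(x) = 1` or `p ∣ e`. -/
theorem exists_poleOrder {D' : EffectiveDivisor X} (hD : D'.IsReduced) {x : X.toScheme}
    (hx : IsClosed {x}) : ∃ m : ℕ,
      (∀ E : EffectiveDivisor Y, E.mult (π.left x) = m ↔ ∀ ω,
        ω ∈ Y.omegaStalk E (π.left x) ↔ Curve.pullDiff π ω ∈ X.omegaStalk D' x) ∧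
      (m ≠ 0 ↔ D'.mult x ≠ 0 ∨ p ∣ ramificationIndex π x) := by
  obtain ⟨u, v, d, a, b, hu, hv, hlu, hlv, ha, hb, hva, hdv, he, hed, hed'⟩ :=
    hπ.exists_local_form p hx
  have hy := (hπ.isClosed_singleton_iff x).mpr hx
  have key := hlu.poleLE_diffMap_iff hlv Y.finrank_merDiff (pull π) (pull_mem_range_toK π x)
    ha hb hva hdv he (D'.mult x)
  refine ⟨(d + D'.mult x) / ramificationIndex π x, fun E => ⟨fun hE ω => ?_, fun hE => ?_⟩, ?_⟩
  · rw [Y.mem_omegaStalk_iff E hy hv, X.mem_omegaStalk_iff D' hx hu, hE]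
    exact key ω
  · refine hlv.eq_of_poleLE_iff fun ω => ?_
    rw [← Y.mem_omegaStalk_iff E hy hv, hE ω, X.mem_omegaStalk_iff D' hx hu]
    exact (key ω).symm
  · rw [← hed', Nat.div_ne_zero_iff]
    have := hD x
    omega

/-- The map `π` is wildly ramified at finitely many points only. -/
theorem finite_dvd_ramificationIndex :
    {x : X.toScheme | IsClosed {x} ∧ p ∣ ramificationIndex π x}.Finite := by
  -- away from finitely many points a fixed `dt` on the quotient pulls back to a generator
  obtain ⟨t, ht⟩ := exists_D_ne_zero Y.finrank_merDiff
  have ht' := hπ.D_pull_ne_zero ht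
  obtain ⟨V, hV, ω, hω⟩ := X.exists_generator
  obtain ⟨c, hc⟩ := exists_smul_D_of_D_ne_zero X.finrank_merDiff ht' ω
  obtain ⟨U₁, hU₁, a, ha⟩ := X.exists_germK_eq c
  obtain ⟨U₂, hU₂, s, hs⟩ := Y.exists_germK_eq t
  have hfin := X.finite_compl (V ⊓ (U₁ ⊓ π.left ⁻¹ᵁ U₂)) ⟨hV, hU₁, pull_genericPoint_mem π hU₂⟩
  refine hfin.subset ?_
  rintro x ⟨hx, hdvd⟩ ⟨hxV, hxU₁, hxU₂⟩
  obtain ⟨u, v, d, a', b, hu, hv, hlu, hlv, -, hb, hva, hdv, he, hed, hed'⟩ :=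
    hπ.exists_local_form p hx
  have hd : d = 0 := by
    refine hlu.different_eq_zero hlv (pull π) (pull_mem_range_toK π x) hb hdv (t := t) ?_ ?_
    · rw [← hs, Y.germK_eq U₂ _ _ hU₂ hxU₂]
      exact ⟨_, rfl⟩
    · obtain ⟨g, hg⟩ := hω x hxV u
      refine ⟨X.toK x g * c, ?_, by rw [hg, hc, smul_smul]⟩
      refine (X.toK x).range.mul_mem ⟨g, rfl⟩ ?_
      rw [← ha, X.germK_eq U₁ _ _ hU₁ hxU₁]
      exact ⟨_, rfl⟩
  have := hed'.mpr hdvd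
  omega

omit [IsDominant π.left] in
/-- The divisor `E_D` on the quotient: its stalks consist of the differentials whose pullback lies
in the stalks of `Ω_X(D)`. -/
theorem exists_poleDivisor {D' : EffectiveDivisor X} (hD : D'.IsReduced) (hN : D'.IsInvariant N) :
    ∃ E : EffectiveDivisor Y, ∀ x ω,
      ω ∈ Y.omegaStalk E (π.left x) ↔ hπ.pullDiff ω ∈ X.omegaStalk D' x := by
  have := hπ.isDominant
  obtain ⟨p, _⟩ := CharP.exists k
  classical
  -- the multiplicity at `y` is computed at a chosen point `s y` over `y`
  choose s hs using hπ.isQuotientMap.surjective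
  choose m hm hm' using fun (x : X.toScheme) (hx : IsClosed {x}) => hπ.exists_poleOrder p hD hx
  let f : Y.toScheme → ℕ := fun y => if h : IsClosed {s y} then m (s y) h else 0
  have hf : {y | f y ≠ 0}.Finite := by
    refine ((D'.mult.hasFiniteSupport.union (hπ.finite_dvd_ramificationIndex p)).image
      π.left).subset ?_
    intro y hy
    have hy' : f y ≠ 0 := hy
    refine ⟨s y, ?_, hs y⟩
    by_cases h : IsClosed {s y}
    · simp only [f, dif_pos h] at hy'
      rcases (hm' _ h).mp hy' with h1 | h1
      · exact Or.inl h1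
      · exact Or.inr ⟨h, h1⟩
    · simp only [f, dif_neg h, ne_eq, not_true_eq_false] at hy'
  let E : EffectiveDivisor Y :=
    { mult := Finsupp.ofSupportFinite f hf
      isClosed := fun y hy => by
        change f y ≠ 0 at hy
        by_contra h
        rw [← hs y, hπ.isClosed_singleton_iff] at h
        simp only [f, dif_neg h, ne_eq, not_true_eq_false] at hy }
  refine ⟨E, fun x ω => ?_⟩
  change _ ↔ Curve.pullDiff π ω ∈ _
  by_cases hx : IsClosed {x}
  · -- the divisor `D` is `N`-invariant, so `x` may be replaced by the chosen point of its orbit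
    obtain ⟨n, hn, hnx⟩ := hπ.orbit _ x (hs (π.left x))
    have hsx : IsClosed {s (π.left x)} := by
      rw [← hπ.isClosed_singleton_iff, hs, hπ.isClosed_singleton_iff]; exact hx
    have hE : E.mult (π.left (s (π.left x))) = m _ hsx := by
      rw [hs]
      exact dif_pos hsx
    have h1 := (hm _ hsx E).mp hE ω
    rw [hs] at h1
    rw [h1, ← hπ.pullDiff_pullDiff_aut hn ω, pullDiff_mem_omegaStalk_iff n (hN n hn _), hnx,
      hπ.pullDiff_pullDiff_aut hn ω]
  · obtain rfl := (X.isClosed_or_eq_genericPoint x).resolve_left hx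
    rw [map_genericPoint]
    exact iff_of_true (Y.omegaStalk_genericPoint E ω) (X.omegaStalk_genericPoint D' _)

variable {E : EffectiveDivisor Y} {D' : EffectiveDivisor X}

omit [IsDominant π.left] in
theorem support_poleDivisor (hD : D'.IsReduced) (hE : ∀ x ω,
      ω ∈ Y.omegaStalk E (π.left x) ↔ hπ.pullDiff ω ∈ X.omegaStalk D' x) :
    {y | E.mult y ≠ 0} = π.left '' {x | D'.mult x ≠ 0} ∪ {y | IsWildlyRamifiedOver p π y} := by
  have := hπ.isDominant
  have key : ∀ x, IsClosed {x} →
      (E.mult (π.left x) ≠ 0 ↔ D'.mult x ≠ 0 ∨ p ∣ ramificationIndex π x) := by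
    intro x hx
    obtain ⟨m, hm, hm'⟩ := hπ.exists_poleOrder p hD hx
    rw [(hm E).mpr (hE x), hm']
  ext y
  constructor
  · intro hy
    obtain ⟨x, rfl⟩ := hπ.isQuotientMap.surjective y
    have hx := (hπ.isClosed_singleton_iff x).mp (E.isClosed _ hy)
    rcases (key x hx).mp hy with h | h
    · exact Or.inl ⟨x, h, rfl⟩
    · exact Or.inr ⟨E.isClosed _ hy, x, hx, rfl, h⟩
  · rintro (⟨x, hx, rfl⟩ | ⟨-, x, hx, rfl, h⟩)
    · exact (key x (D'.isClosed x hx)).mpr (Or.inl hx)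
    · exact (key x hx).mpr (Or.inr h)

omit [IsDominant π.left] in
/-- The divisor on the quotient is determined by its stalks, hence compatible with automorphisms. -/
theorem isPullback_poleDivisor (g : Aut X.toOver) (h : Aut Y.toOver)
    (hgh : g.hom ≫ π = π ≫ h.hom) {E' : EffectiveDivisor Y} {D'' : EffectiveDivisor X}
    (hD : D''.IsReduced) (hg : D'.IsPullback g D'')
    (hE : ∀ x ω, ω ∈ Y.omegaStalk E (π.left x) ↔ hπ.pullDiff ω ∈ X.omegaStalk D' x)
    (hE' : ∀ x ω, ω ∈ Y.omegaStalk E' (π.left x) ↔ hπ.pullDiff ω ∈ X.omegaStalk D'' x) :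
    E.IsPullback h E' := by
  have := hπ.isDominant
  obtain ⟨p, _⟩ := CharP.exists k
  intro y
  obtain ⟨x, rfl⟩ := hπ.isQuotientMap.surjective y
  have hleft : h.hom.left (π.left x) = π.left (g.hom.left x) :=
    (congrArg (fun f : X.toOver ⟶ Y.toOver => f.left x) hgh).symm
  by_cases hx : IsClosed {x}
  · obtain ⟨m, hm, -⟩ := hπ.exists_poleOrder p hD hx
    -- `F` is the part at `π(x)` of the pullback of `E` along `h`; it has the stalk of `E'` there
    have hy := (hπ.isClosed_singleton_iff x).mpr hx
    let F : EffectiveDivisor Y :=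
      { mult := Finsupp.single (π.left x) (E.mult (h.hom.left (π.left x)))
        isClosed := fun z hz => by
          classical
          rw [Finsupp.single_apply] at hz
          split_ifs at hz with hzx
          · exact hzx ▸ hy
          · exact absurd rfl hz }
    have hF : F.mult (π.left x) = E.mult (h.hom.left (π.left x)) := Finsupp.single_eq_same
    rw [← hF, (hm E').mpr (hE' x)]
    refine ((hm F).mpr fun η => ?_).symm
    obtain ⟨ω, rfl⟩ : ∃ ω, Curve.pullDiff h.hom ω = η :=
      ⟨Curve.pullDiff h⁻¹.hom η, by simpa using Curve.pullDiff_aut_inv h⁻¹ η⟩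
    rw [pullDiff_mem_omegaStalk_iff h hF, hleft, hE, ← pullDiff_mem_omegaStalk_iff g (hg x)]
    change Curve.pullDiff g.hom (Curve.pullDiff π ω) ∈ _ ↔ _
    rw [Curve.pullDiff_comm π hgh ω]
  · have h1 : ¬ IsClosed {π.left x} := fun H => hx ((hπ.isClosed_singleton_iff x).mp H)
    have h2 : ¬ IsClosed {h.hom.left (π.left x)} := by
      obtain rfl := (X.isClosed_or_eq_genericPoint x).resolve_left hx
      rw [map_genericPoint, map_genericPoint]
      exact Y.not_isClosed_genericPoint
    rw [not_not.mp fun H => h1 (E'.isClosed _ H), not_not.mp fun H => h2 (E.isClosed _ H)]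

end IsQuotient

end PinkDifferentials
end

/-! ### The isomorphism of sheaves -/

noncomputable section

namespace PinkDifferentials

open KaehlerDifferential (D)
open IsLocalRing Curve

variable {k : Type u} [Field k] {X Y : Curve k}

namespace Curve

theorem cartier_mem_omegaStalk [IsAlgClosed k] (p : ℕ) [Fact p.Prime] [CharP k p]
    {D' : EffectiveDivisor X} {x : X.toScheme} {ω : X.MerDiff} (hω : ω ∈ X.omegaStalk D' x) :
    cartier k p ω ∈ X.omegaStalk D' x := by
  have : CharP X.K p := charP_of_injective_algebraMap (algebraMap k X.K).injective p
  by_cases hx : IsClosed {x}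
  · obtain ⟨⟨u, hu⟩, hpu, -⟩ := X.isLocalParameter_and_isDiscreteValuationRing x hx
    rw [X.mem_omegaStalk_iff D' hx hu] at hω ⊢
    exact (hpu u hu).poleLE_cartier X.finrank_merDiff hω
  · obtain rfl := (X.isClosed_or_eq_genericPoint x).resolve_left hx
    exact X.omegaStalk_genericPoint D' _

namespace Omega

variable {D' : EffectiveDivisor X} {U : X.toScheme.Opens}

theorem val_mem (s : Γ(X.Omega D', U)) (x : X.toScheme) (hx : x ∈ U) :
    val s x hx ∈ X.omegaStalk D' x :=
  (show X.omegaSections D' U from s).2.1 ⟨x, hx⟩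

theorem val_eq (s : Γ(X.Omega D', U)) (x y : X.toScheme) (hx : x ∈ U) (hy : y ∈ U) :
    val s x hx = val s y hy :=
  (show X.omegaSections D' U from s).2.2 ⟨x, hx⟩ ⟨y, hy⟩

theorem ext {s t : Γ(X.Omega D', U)} (h : ∀ x hx, val s x hx = val t x hx) : s = t :=
  Subtype.ext (a1 := (show X.omegaSections D' U from s)) (funext fun x => h x x.2)

theorem exists_val_eq (f : U → X.MerDiff) (h : ∀ x : U, f x ∈ X.omegaStalk D' x)
    (h' : ∀ x y : U, f x = f y) : ∃ s : Γ(X.Omega D', U), ∀ x hx, val s x hx = f ⟨x, hx⟩ :=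
  ⟨(⟨f, h, h'⟩ : X.omegaSections D' U), fun _ _ => rfl⟩

end Omega

namespace InvOmega

variable {N : Subgroup (Aut X.toOver)} {π : X.toOver ⟶ Y.toOver}
  {hN : ∀ n ∈ N, n.hom ≫ π = π} {D' : EffectiveDivisor X} {U : Y.toScheme.Opens}

theorem val_mem (s : Γ(InvOmega N π hN D', U)) (x : X.toScheme) (hx : π.left x ∈ U) :
    val s x hx ∈ X.omegaStalk D' x :=
  Omega.val_mem (U := π.left ⁻¹ᵁ U) (show invSections N π hN D' U from s).1 x hx

theorem val_eq (s : Γ(InvOmega N π hN D', U)) (x y : X.toScheme) (hx : π.left x ∈ U)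
    (hy : π.left y ∈ U) : val s x hx = val s y hy :=
  Omega.val_eq (U := π.left ⁻¹ᵁ U) (show invSections N π hN D' U from s).1 x y hx hy

theorem pullDiff_val (s : Γ(InvOmega N π hN D', U)) {n : Aut X.toOver} (hn : n ∈ N)
    (x : X.toScheme) (hx : π.left x ∈ U) : pullDiff n.hom (val s x hx) = val s x hx := by
  have h : π.left (n.hom.left x) = π.left x :=
    congrArg (fun f : X.toOver ⟶ Y.toOver => f.left x) (hN n hn)
  have hnx : π.left (n.hom.left x) ∈ U := h ▸ hx
  refine Eq.trans ?_ ((show invSections N π hN D' U from s).2 n hn x hx hnx)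
  exact congrArg (pullDiff n.hom) (val_eq s x _ hx hnx)

theorem ext {s t : Γ(InvOmega N π hN D', U)} (h : ∀ x hx, val s x hx = val t x hx) : s = t :=
  Subtype.ext (a1 := (show invSections N π hN D' U from s))
    (Omega.ext (U := π.left ⁻¹ᵁ U) fun x hx => h x hx)

theorem exists_val_eq (f : (π.left ⁻¹ᵁ U : X.toScheme.Opens) → X.MerDiff)
    (h : ∀ x, f x ∈ X.omegaStalk D' x.1) (h' : ∀ x y, f x = f y)
    (hf : ∀ n ∈ N, ∀ x, pullDiff n.hom (f x) = f x) :
    ∃ s : Γ(InvOmega N π hN D', U), ∀ x hx, val s x hx = f ⟨x, hx⟩ := by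
  obtain ⟨s, hs⟩ := Omega.exists_val_eq (D' := D') f h h'
  refine ⟨(⟨s, fun n hn x hx hnx => ?_⟩ : invSections N π hN D' U), fun x hx => hs x hx⟩
  rw [hs x hx, hs _ hnx, h' ⟨_, hnx⟩ ⟨x, hx⟩]
  exact hf n hn _

end InvOmega

end Curve

namespace IsQuotient

variable {N : Subgroup (Aut X.toOver)} {π : X.toOver ⟶ Y.toOver} (hπ : IsQuotient N π)
  {D' : EffectiveDivisor X} {E : EffectiveDivisor Y}
  (hE : ∀ x ω, ω ∈ Y.omegaStalk E (π.left x) ↔ hπ.pullDiff ω ∈ X.omegaStalk D' x)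

/-- Pullback of differentials as a map from the sections of `Ω_Y(E)` to those of
`(π_* Ω_X(D))^N`. -/
def pullSection (U : Y.toScheme.Opens) :
    Y.omegaSections E U →ₗ[Γ(Y.toScheme, U)] invSections N π hπ.invariant D' U where
  toFun s := ⟨(⟨fun x => hπ.pullDiff (s.1 ⟨π.left x.1, x.2⟩),
      fun x => (hE x.1 _).mp (s.2.1 ⟨π.left x.1, x.2⟩),
      fun x y => congrArg hπ.pullDiff (s.2.2 ⟨π.left x.1, x.2⟩ ⟨π.left y.1, y.2⟩)⟩ :
        X.omegaSections D' (π.left ⁻¹ᵁ U)), fun n hn x hx hnx => by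
      have := hπ.isDominant
      refine Eq.trans ?_ (hπ.pullDiff_pullDiff_aut hn (s.1 ⟨π.left x, hx⟩))
      exact congrArg (fun ω => Curve.pullDiff n.hom (Curve.pullDiff π ω))
        (s.2.2 ⟨π.left (n.hom.left x), hnx⟩ ⟨π.left x, hx⟩)⟩
  map_add' s t := Subtype.ext <| Subtype.ext <| funext fun x => map_add hπ.pullDiff _ _
  map_smul' a s := Subtype.ext <| Subtype.ext <| funext fun x => by
    have := hπ.isDominant
    refine (diffMap_smul (pull π) _ (s.1 ⟨π.left x.1, x.2⟩)).trans ?_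
    exact congrArg (fun c : X.K => c • Curve.pullDiff π (s.1 ⟨π.left x.1, x.2⟩))
      (pullRing_germK π U x.1 x.2 a)

/-- Pullback of differentials as a morphism of sheaves of modules
`Ω_Y(E) → (π_* Ω_X(D))^N`. -/
def pullOmega : Y.Omega E ⟶ InvOmega N π hπ.invariant D' :=
  SheafOfModules.Hom.mk
    { app := fun U => ModuleCat.ofHom (hπ.pullSection hE U.unop)
      naturality := fun i => by ext; rfl }

theorem val_pullOmega_app {U : Y.toScheme.Opens} (s : Γ(Y.Omega E, U)) (x : X.toScheme)
    (hx : π.left x ∈ U) :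
    InvOmega.val ((hπ.pullOmega hE).app U s) x hx = hπ.pullDiff (Omega.val s (π.left x) hx) :=
  rfl

theorem isIso_pullOmega [Finite N] : IsIso (hπ.pullOmega hE) := by
  have := hπ.isDominant
  rw [Scheme.Modules.Hom.isIso_iff_isIso_app]
  intro U
  rw [ConcreteCategory.isIso_iff_bijective]
  refine ⟨fun s t hst => Omega.ext fun y hy => ?_, fun s => ?_⟩
  · obtain ⟨x, rfl⟩ := hπ.isQuotientMap.surjective y
    refine hπ.pullDiff_injective ?_
    exact congrArg (fun s => InvOmega.val s x hy) hst
  · have h : ∀ y : U, ∃ η : Y.MerDiff, η ∈ Y.omegaStalk E y ∧ ∀ x hx,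
        hπ.pullDiff η = InvOmega.val s x hx := by
      rintro ⟨y, hy⟩
      obtain ⟨x, rfl⟩ := hπ.isQuotientMap.surjective y
      obtain ⟨η, hη⟩ := hπ.exists_pullDiff_eq (InvOmega.val s x hy) fun n hn =>
        InvOmega.pullDiff_val s hn x hy
      have hη' : hπ.pullDiff η = InvOmega.val s x hy := hη
      refine ⟨η, (hE x η).mpr ?_, fun z hz => hη'.trans (InvOmega.val_eq s x z hy hz)⟩
      rw [hη']
      exact InvOmega.val_mem s x hy
    choose f hf hf' using h
    obtain ⟨t, ht⟩ := Omega.exists_val_eq (D' := E) f hf fun y z => by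
      obtain ⟨x, hx⟩ := hπ.isQuotientMap.surjective y.1
      have hxU : π.left x ∈ U := hx ▸ y.2
      exact hπ.pullDiff_injective ((hf' y x hxU).trans (hf' z x hxU).symm)
    refine ⟨t, InvOmega.ext fun x hx => ?_⟩
    rw [val_pullOmega_app, ht]
    exact hf' _ x hx

/-- The inverse of the pullback of differentials, `(π_* Ω_X(D))^N ≅ Ω_Y(E)`. -/
def omegaIso [Finite N] : InvOmega N π hπ.invariant D' ≅ Y.Omega E :=
  haveI := hπ.isIso_pullOmega hE
  (asIso (hπ.pullOmega hE)).symm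

theorem pullDiff_val_omegaIso [Finite N] {U : Y.toScheme.Opens}
    (s : Γ(InvOmega N π hπ.invariant D', U)) (x : X.toScheme) (hx : π.left x ∈ U) :
    hπ.pullDiff (Omega.val ((hπ.omegaIso hE).hom.app U s) (π.left x) hx) =
      InvOmega.val s x hx := by
  rw [← val_pullOmega_app (hE := hE)]
  have h : (hπ.omegaIso hE).hom ≫ hπ.pullOmega hE = 𝟙 _ := (hπ.omegaIso hE).hom_inv_id
  have h2 := congrArg (fun f => Scheme.Modules.Hom.app f U) h
  exact congrArg (fun s => InvOmega.val s x hx) (ConcreteCategory.congr_hom h2 s)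

/-- The Cartier operator preserves the sections of `(π_* Ω_X(D))^N` and of `Ω_Y(E)`. -/
theorem exists_cartier_section [IsAlgClosed k] [Finite N] (p : ℕ) [Fact p.Prime] [CharP k p]
    {U : Y.toScheme.Opens} (s : Γ(InvOmega N π hπ.invariant D', U)) :
    ∃ s' : Γ(InvOmega N π hπ.invariant D', U),
      (∀ x hx, InvOmega.val s' x hx = cartier k p (InvOmega.val s x hx)) ∧
      ∀ y hy, Omega.val ((hπ.omegaIso hE).hom.app U s') y hy =
        cartier k p (Omega.val ((hπ.omegaIso hE).hom.app U s) y hy) := by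
  have := hπ.isDominant
  have key : ∀ x hx, cartier k p (InvOmega.val s x hx) = Curve.pullDiff π
      (cartier k p (Omega.val ((hπ.omegaIso hE).hom.app U s) (π.left x) hx)) := by
    intro x hx
    rw [← hπ.cartier_pullDiff, ← hπ.pullDiff_val_omegaIso hE s x hx]
    rfl
  obtain ⟨s', hs'⟩ := InvOmega.exists_val_eq (N := N) (hN := hπ.invariant) (D' := D') (U := U)
    (fun x => cartier k p (InvOmega.val s x.1 x.2))
    (fun x => cartier_mem_omegaStalk p (InvOmega.val_mem s x.1 x.2))
    (fun x y => congrArg (cartier k p) (InvOmega.val_eq s x.1 y.1 x.2 y.2))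
    (fun n hn x => by rw [key x.1 x.2, hπ.pullDiff_pullDiff_aut hn])
  refine ⟨s', hs', fun y hy => ?_⟩
  obtain ⟨x, rfl⟩ := hπ.isQuotientMap.surjective y
  refine hπ.pullDiff_injective ?_
  refine (hπ.pullDiff_val_omegaIso hE s' x hy).trans ?_
  rw [hs' x hy]
  exact key x hy

/-- A pair of automorphisms of `X` and `Y` compatible with `π` acts compatibly on the sections of
the two sheaves. -/
theorem exists_pullback_section [Finite N] {D'' : EffectiveDivisor X} {E' : EffectiveDivisor Y}
    (hE' : ∀ x ω, ω ∈ Y.omegaStalk E' (π.left x) ↔ hπ.pullDiff ω ∈ X.omegaStalk D'' x)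
    {g : Aut X.toOver} {h : Aut Y.toOver} (hgh : g.hom ≫ π = π ≫ h.hom)
    (hg : D'.IsPullback g D'') {U : Y.toScheme.Opens} (s : Γ(InvOmega N π hπ.invariant D', U)) :
    ∃ s' : Γ(InvOmega N π hπ.invariant D'', h.hom.left ⁻¹ᵁ U),
      (∀ x hx hgx, InvOmega.val s' x hx =
        Curve.pullDiff g.hom (InvOmega.val s (g.hom.left x) hgx)) ∧
      ∀ y hy hgy, Omega.val ((hπ.omegaIso hE').hom.app _ s') y hy =
        Curve.pullDiff h.hom (Omega.val ((hπ.omegaIso hE).hom.app U s) (h.hom.left y) hgy) := by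
  have := hπ.isDominant
  have hleft : ∀ x, h.hom.left (π.left x) = π.left (g.hom.left x) := fun x =>
    (congrArg (fun f : X.toOver ⟶ Y.toOver => f.left x) hgh).symm
  have hU : ∀ x : (π.left ⁻¹ᵁ h.hom.left ⁻¹ᵁ U : X.toScheme.Opens),
      π.left (g.hom.left x.1) ∈ U := fun x => hleft x.1 ▸ x.2
  have key : ∀ x hgx, Curve.pullDiff g.hom (InvOmega.val s x hgx) = Curve.pullDiff π
      (Curve.pullDiff h.hom (Omega.val ((hπ.omegaIso hE).hom.app U s) (π.left x) hgx)) := by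
    intro x hgx
    rw [← hπ.pullDiff_val_omegaIso hE s x hgx]
    exact Curve.pullDiff_comm π hgh _
  obtain ⟨s', hs'⟩ := InvOmega.exists_val_eq (N := N) (hN := hπ.invariant) (D' := D'')
    (U := h.hom.left ⁻¹ᵁ U)
    (fun x => Curve.pullDiff g.hom (InvOmega.val s (g.hom.left x.1) (hU x)))
    (fun x => (pullDiff_mem_omegaStalk_iff g (hg x.1)).mpr (InvOmega.val_mem s _ (hU x)))
    (fun x y => congrArg (Curve.pullDiff g.hom) (InvOmega.val_eq s _ _ (hU x) (hU y)))
    (fun n hn x => by rw [key _ (hU x), hπ.pullDiff_pullDiff_aut hn])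
  refine ⟨s', fun x hx _ => hs' x hx, fun y hy hgy => ?_⟩
  obtain ⟨x, rfl⟩ := hπ.isQuotientMap.surjective y
  refine hπ.pullDiff_injective ?_
  refine (hπ.pullDiff_val_omegaIso hE' s' x hy).trans ?_
  rw [hs' x hy]
  refine (key _ (hU ⟨x, hy⟩)).trans
    (congrArg (fun ω => Curve.pullDiff π (Curve.pullDiff h.hom ω)) ?_)
  exact Omega.val_eq _ _ _ _ _

end IsQuotient

end PinkDifferentials
end

open PinkDifferentials
theorem mainTheorem4 (k : Type u) [Field k] [IsAlgClosed k] (p : ℕ) [Fact p.Prime] [CharP k p]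
    (X Y : Curve k) (G : Subgroup (Aut X.toOver)) [Finite G] (N : Subgroup G) [N.Normal]
    (π : X.toOver ⟶ Y.toOver) (hπ : IsQuotient (N.map G.subtype) π)
    -- the induced action of `G / N` on `Y`
    (σ : G ⧸ N →* Aut Y.toOver)
    (hσ : ∀ g : G, (g : Aut X.toOver).hom ≫ π = π ≫ (σ (QuotientGroup.mk g)).hom) :
    ∃ (E : EffectiveDivisor X → EffectiveDivisor Y)
      (φ : ∀ D : EffectiveDivisor X, D.IsReduced → D.IsInvariant (N.map G.subtype) →
        (Curve.InvOmega (N.map G.subtype) π hπ.invariant D ≅ Y.Omega (E D))),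
      ∀ (D : EffectiveDivisor X) (hD : D.IsReduced) (hN : D.IsInvariant (N.map G.subtype)),
        -- the support of `E`
        ({y | (E D).mult y ≠ 0} =
          π.left '' {x | D.mult x ≠ 0} ∪ {y | IsWildlyRamifiedOver p π y}) ∧
        -- naturality: the inverse of `φ` is the pullback of differentials
        (∀ (U : Y.toScheme.Opens) (s : Γ(Curve.InvOmega (N.map G.subtype) π hπ.invariant D, U))
          (x : X.toScheme) (hx : π.left x ∈ U),
          hπ.pullDiff (Curve.Omega.val ((φ D hD hN).hom.app U s) (π.left x) hx) =
            Curve.InvOmega.val s x hx) ∧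
        -- the Cartier operator acts on both sheaves and commutes with `φ`
        (∀ (U : Y.toScheme.Opens) (s : Γ(Curve.InvOmega (N.map G.subtype) π hπ.invariant D, U)),
          ∃ s' : Γ(Curve.InvOmega (N.map G.subtype) π hπ.invariant D, U),
            (∀ x hx, Curve.InvOmega.val s' x hx = cartier k p (Curve.InvOmega.val s x hx)) ∧
            ∀ y hy, Curve.Omega.val ((φ D hD hN).hom.app U s') y hy =
              cartier k p (Curve.Omega.val ((φ D hD hN).hom.app U s) y hy)) ∧
        -- `g ∈ G` carries the data for `D` to those for `g^* D`, and commutes with `φ`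
        (∀ (g : G) (D' : EffectiveDivisor X) (hD' : D'.IsReduced)
          (hN' : D'.IsInvariant (N.map G.subtype)), D.IsPullback (g : Aut X.toOver) D' →
          (E D).IsPullback (σ (QuotientGroup.mk g)) (E D') ∧
          ∀ (U : Y.toScheme.Opens) (s : Γ(Curve.InvOmega (N.map G.subtype) π hπ.invariant D, U)),
            ∃ s' : Γ(Curve.InvOmega (N.map G.subtype) π hπ.invariant D',
                (σ (QuotientGroup.mk g)).hom.left ⁻¹ᵁ U),
              (∀ x hx hgx, Curve.InvOmega.val s' x hx =
                Curve.pullDiff (g : Aut X.toOver).hom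
                  (Curve.InvOmega.val s ((g : Aut X.toOver).hom.left x) hgx)) ∧
              ∀ y hy hgy, Curve.Omega.val ((φ D' hD' hN').hom.app _ s') y hy =
                Curve.pullDiff (σ (QuotientGroup.mk g)).hom
                  (Curve.Omega.val ((φ D hD hN).hom.app U s)
                    ((σ (QuotientGroup.mk g)).hom.left y) hgy)) := by
  have : Finite (N.map G.subtype : Subgroup (Aut X.toOver)) :=
    ((N : Set G).toFinite.image G.subtype).to_subtype
  classical
  choose E hE using fun (D : EffectiveDivisor X) (hD : D.IsReduced)
    (hN : D.IsInvariant (N.map G.subtype)) => hπ.exists_poleDivisor hD hN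
  -- outside the reduced invariant divisors the value of `E` is irrelevant
  let E₀ : EffectiveDivisor Y := ⟨0, fun _ h => absurd rfl h⟩
  let F : EffectiveDivisor X → EffectiveDivisor Y := fun D =>
    if h : D.IsReduced ∧ D.IsInvariant (N.map G.subtype) then E D h.1 h.2 else E₀
  have hF : ∀ (D : EffectiveDivisor X) (_ : D.IsReduced) (_ : D.IsInvariant (N.map G.subtype)),
      ∀ x ω, ω ∈ Y.omegaStalk (F D) (π.left x) ↔ hπ.pullDiff ω ∈ X.omegaStalk D x := by
    intro D hD hN
    simp only [F, dif_pos (And.intro hD hN)]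
    exact hE D hD hN
  refine ⟨F, fun D hD hN => hπ.omegaIso (hF D hD hN), fun D hD hN =>
    ⟨hπ.support_poleDivisor p hD (hF D hD hN), fun U s x hx =>
      hπ.pullDiff_val_omegaIso _ s x hx, fun U s => hπ.exists_cartier_section _ p s,
      fun g D' hD' hN' hg => ⟨hπ.isPullback_poleDivisor g _ (hσ g) hD' hg (hF D hD hN)
        (hF D' hD' hN'), fun U s => hπ.exists_pullback_section _ _ (hσ g) hg s⟩⟩⟩
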